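/- Let $X, Y \subset \mathbb{R}^2 \simeq \mathbb{C}$ be bounded domains (nonempty, connected, open, bounded sets) and let $h : X \to Y$ be a conformal map of $X$ onto $Y$, i.e. a holomorphic bijection. For a map $g : X \to \mathbb{C}$ with weak partial derivatives $g_x, g_y \in L^1_{\mathrm{loc}}(X)$, let $$\mathscr{E}_2[g] = \int_X |Dg|^2 = \int_X \left( |g_x|^2 + |g_y|^2 \right) dx\,dy \in [0, \infty]$$ be its Dirichlet energy ($|Dg|$ is the Hilbert–Schmidt norm of the differential). Let $f : X \to Y$ be an orientation-preserving homeomorphism of $X$ onto $Y$ of Sobolev class $W^{1,2}(X, \mathbb{C})$; here orientation-preserving means that for every closed disc contained in $X$, the image under $f$ of its positively oriented boundary circle has winding number $1$ around the image of its centre. Then $$\mathscr{E}_2[h] \le \mathscr{E}_2[f],$$ and equality $\mathscr{E}_2[f] = \mathscr{E}_2[h]$ holds if and only if $f$ is a conformal map of $X$ onto $Y$ as well. -/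

import Mathlib

open MeasureTheory Set
open scoped ENNReal ContDiff

/-- `X` is a bounded planar domain: a nonempty, connected, open and bounded subset of `ℂ`. -/
structure IsBoundedDomain (X : Set ℂ) : Prop where
  isOpen : IsOpen X
  isConnected : IsConnected X
  isBounded : Bornology.IsBounded X

/-- `f` restricts to a homeomorphism of `X` onto `Y` (values of `f` outside `X` are irrelevant). -/
def IsHomeomorphOnto (f : ℂ → ℂ) (X Y : Set ℂ) : Prop :=
  ∃ e : X ≃ₜ Y, ∀ z : X, (e z : ℂ) = f z

/-- `f` is a conformal map of the open set `X` onto `Y`: a holomorphic bijection. -/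
structure IsConformalOnto (f : ℂ → ℂ) (X Y : Set ℂ) : Prop where
  differentiableOn : DifferentiableOn ℂ f X
  bijOn : BijOn f X Y

/-- The curve `γ`, parametrized by `[0, 2π]`, avoids the point `w` and has winding number `n`
around it: `γ - w` has a continuous logarithm along the curve, with increment `2πin`. -/
def HasWindingNumber (γ : ℝ → ℂ) (w : ℂ) (n : ℤ) : Prop :=
  ∃ L : ℝ → ℂ, ContinuousOn L (Icc 0 (2 * Real.pi)) ∧
    (∀ t ∈ Icc 0 (2 * Real.pi), Complex.exp (L t) = γ t - w) ∧
    L (2 * Real.pi) - L 0 = n * (2 * Real.pi * Complex.I)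

/-- A (continuous, injective) map `f` preserves orientation on `X`: it has local degree `1`, that
is, it sends each positively oriented circle bounding a closed disc in `X` to a curve with
winding number `1` around the image of the centre. -/
def PreservesOrientationOn (f : ℂ → ℂ) (X : Set ℂ) : Prop :=
  ∀ z : ℂ, ∀ r : ℝ, 0 < r → Metric.closedBall z r ⊆ X →
    HasWindingNumber (fun t : ℝ => f (circleMap z r t)) (f z) 1

/-- `g` is the weak (distributional) derivative of `f` on `X` in the direction `v`. -/
structure HasWeakPartial (X : Set ℂ) (f : ℂ → ℂ) (v : ℂ) (g : ℂ → ℂ) : Prop where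
  locallyIntegrableOn : LocallyIntegrableOn f X
  locallyIntegrableOn_deriv : LocallyIntegrableOn g X
  integral_eq : ∀ φ : ℂ → ℝ, ContDiff ℝ ∞ φ → HasCompactSupport φ → tsupport φ ⊆ X →
    ∫ z in X, (fderiv ℝ φ z v) • f z = - ∫ z in X, φ z • g z

/-- `f` is of Sobolev class `W^{1,2}(X, ℂ)`: `f` and its weak partial derivatives `∂f/∂x`, `∂f/∂y`
(directions `1` and `i`) are square integrable on `X`. -/
def MemSobolevOneTwo (X : Set ℂ) (f : ℂ → ℂ) : Prop :=
  MemLp f 2 (volume.restrict X) ∧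
    ∃ fx fy : ℂ → ℂ, HasWeakPartial X f 1 fx ∧ HasWeakPartial X f Complex.I fy ∧
      MemLp fx 2 (volume.restrict X) ∧ MemLp fy 2 (volume.restrict X)

/-- The Dirichlet energy `∫_X |Df|²`, where `|Df|² = |∂f/∂x|² + |∂f/∂y|²` is the squared
Hilbert-Schmidt norm of the weak differential. Weak derivatives being unique almost everywhere,
the infimum is over equal numbers (see `dirichletEnergy_eq`); it is `∞` if there are no weak
derivatives. -/
noncomputable def dirichletEnergy (X : Set ℂ) (f : ℂ → ℂ) : ℝ≥0∞ :=
  ⨅ (fx : ℂ → ℂ) (fy : ℂ → ℂ) (_ : HasWeakPartial X f 1 fx)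
    (_ : HasWeakPartial X f Complex.I fy), ∫⁻ z in X, (‖fx z‖ₑ ^ 2 + ‖fy z‖ₑ ^ 2)

theorem HasWeakPartial.ae_eq {X : Set ℂ} (hX : IsOpen X) {f g g' : ℂ → ℂ} {v : ℂ}
    (h : HasWeakPartial X f v g) (h' : HasWeakPartial X f v g') :
    g =ᵐ[volume.restrict X] g' := by
  have key : ∀ᵐ z ∂(volume : Measure ℂ), z ∈ X → (g - g') z = 0 := by
    refine hX.ae_eq_zero_of_integral_contDiff_smul_eq_zero
      (h.locallyIntegrableOn_deriv.sub h'.locallyIntegrableOn_deriv) ?_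
    intro φ hφ hc hs
    have int : ∀ u : ℂ → ℂ, LocallyIntegrableOn u X → IntegrableOn (fun z => φ z • u z) X := by
      intro u hu
      have h1 : IntegrableOn (fun z => φ z • u z) (tsupport φ) :=
        (hu.integrableOn_compact_subset hs hc).continuousOn_smul hφ.continuous.continuousOn hc
      refine (h1.integrable_of_forall_notMem_eq_zero fun z hz => ?_).integrableOn
      rw [image_eq_zero_of_notMem_tsupport hz, zero_smul]
    have e := (h.integral_eq φ hφ hc hs).symm.trans (h'.integral_eq φ hφ hc hs)
    have e' := neg_injective e
    have : ∫ z in X, φ z • (g - g') z = 0 := by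
      simp only [Pi.sub_apply, smul_sub]
      rw [integral_sub (int g h.locallyIntegrableOn_deriv) (int g' h'.locallyIntegrableOn_deriv),
        e', sub_self]
    rw [← this, setIntegral_eq_integral_of_forall_compl_eq_zero]
    intro z hz
    rw [image_eq_zero_of_notMem_tsupport (fun hz' => hz (hs hz')), zero_smul]
  filter_upwards [(ae_restrict_iff' hX.measurableSet).2 key] with z hz
  exact sub_eq_zero.1 hz

theorem dirichletEnergy_eq {X : Set ℂ} (hX : IsOpen X) {f fx fy : ℂ → ℂ}
    (hx : HasWeakPartial X f 1 fx) (hy : HasWeakPartial X f Complex.I fy) :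
    dirichletEnergy X f = ∫⁻ z in X, (‖fx z‖ₑ ^ 2 + ‖fy z‖ₑ ^ 2) := by
  refine le_antisymm (iInf₂_le_of_le fx fy (iInf₂_le_of_le hx hy le_rfl)) ?_
  refine le_iInf₂ fun gx gy => le_iInf₂ fun kx ky => le_of_eq (lintegral_congr_ae ?_)
  filter_upwards [hx.ae_eq hX kx, hy.ae_eq hX ky] with z h1 h2
  rw [h1, h2]

/-! Pointwise, |f_x|² + |f_y|² = 2 J + |f_x + i f_y|², where J is the Jacobian and f_x + i f_y is
twice the Cauchy-Riemann derivative (`norm_sq_add_norm_sq_eq`). If J integrates to at least the area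
of Y, then the energy of f is at least 2|Y|, which is exactly the energy of h by the change of
variables formula (`IsConformalOnto.dirichletEnergy_eq`). In the equality case the remainder |f_x +
i f_y|² must vanish almost everywhere, and Weyl's lemma (`differentiableOn_of_weak_cauchyRiemann`)
makes f holomorphic.

The area inequality must be proved for a map that is only a Sobolev homeomorphism, so degree theory
replaces the change of variables. For a smooth g on a disc whose boundary curve winds once around w₀
and stays away from it, Green's formula evaluates the integral of σ(|g - w₀|²) J_g for radial
weights σ supported near 0 (`integral_radial_wedge`). This applies to mollifications of f: they are
uniformly close to f, so the winding number survives, and Jensen's inequality bounds their energy by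
that of f. Letting the mollification scale tend to 0, with Fatou's lemma for the remainder, gives
the energy inequality on preimages of small discs centred at any point of Y
(`le_lintegral_energy_preimage_ball`). A Besicovitch covering of almost all of Y by disjoint discs
then sums these local bounds (`IsHomeomorphOnto.le_lintegral_energy`). -/

/-! ### Green's formula for angular forms on rectangles and discs -/

/-- The imaginary part of `conj a * b`: the signed area of the parallelogram spanned by `a, b`. -/
def wedge (a b : ℂ) : ℝ := a.re * b.im - a.im * b.re

/-- The pullback by `G` of the form `F(|w|²) Im(conj w dw)`, evaluated at the vector `v`. -/
noncomputable def angularForm {V : Type*} [NormedAddCommGroup V] [NormedSpace ℝ V]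
    (F : ℝ → ℝ) (G : V → ℂ) (v : V) (p : V) : ℝ :=
  F ((G p).re ^ 2 + (G p).im ^ 2) * wedge (G p) (fderiv ℝ G p v)

section

variable {V : Type*} [NormedAddCommGroup V] [NormedSpace ℝ V]

theorem contDiff_angularForm {F : ℝ → ℝ} {G : V → ℂ} (hF : ContDiff ℝ 1 F) (hG : ContDiff ℝ 2 G)
    (v : V) : ContDiff ℝ 1 (angularForm F G v) := by
  have h1 : ContDiff ℝ 1 G := hG.of_le (by norm_num)
  have hre : ContDiff ℝ 1 (fun p => (G p).re) := Complex.reCLM.contDiff.comp h1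
  have him : ContDiff ℝ 1 (fun p => (G p).im) := Complex.imCLM.contDiff.comp h1
  have hD : ContDiff ℝ 1 (fun p => fderiv ℝ G p v) :=
    (hG.fderiv_right (m := 1) (by norm_num)).clm_apply contDiff_const
  have hDre : ContDiff ℝ 1 (fun p => (fderiv ℝ G p v).re) := Complex.reCLM.contDiff.comp hD
  have hDim : ContDiff ℝ 1 (fun p => (fderiv ℝ G p v).im) := Complex.imCLM.contDiff.comp hD
  exact (hF.comp ((hre.pow 2).add (him.pow 2))).mul ((hre.mul hDim).sub (him.mul hDre))

theorem fderiv_angularForm {F : ℝ → ℝ} {G : V → ℂ} (hF : ContDiff ℝ 1 F) (hG : ContDiff ℝ 2 G)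
    (u v : V) (p : V) :
    fderiv ℝ (angularForm F G v) p u =
      deriv F ((G p).re ^ 2 + (G p).im ^ 2) *
        (2 * (G p).re * (fderiv ℝ G p u).re + 2 * (G p).im * (fderiv ℝ G p u).im) *
        wedge (G p) (fderiv ℝ G p v) +
      F ((G p).re ^ 2 + (G p).im ^ 2) *
        (wedge (fderiv ℝ G p u) (fderiv ℝ G p v) +
          wedge (G p) (fderiv ℝ (fderiv ℝ G) p u v)) := by
  have h1 : HasFDerivAt G (fderiv ℝ G p) p :=
    (hG.differentiable (by norm_num) p).hasFDerivAt
  have hre : HasFDerivAt (fun p => (G p).re) (Complex.reCLM ∘L fderiv ℝ G p) p :=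
    Complex.reCLM.hasFDerivAt.comp p h1
  have him : HasFDerivAt (fun p => (G p).im) (Complex.imCLM ∘L fderiv ℝ G p) p :=
    Complex.imCLM.hasFDerivAt.comp p h1
  have hDD : HasFDerivAt (fderiv ℝ G) (fderiv ℝ (fderiv ℝ G) p) p :=
    ((hG.fderiv_right (m := 1) (by norm_num)).differentiable (by norm_num) p).hasFDerivAt
  have hD : HasFDerivAt (fun p => fderiv ℝ G p v)
      ((ContinuousLinearMap.apply ℝ ℂ v) ∘L fderiv ℝ (fderiv ℝ G) p) p :=
    (ContinuousLinearMap.apply ℝ ℂ v).hasFDerivAt.comp p hDD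
  have hDre : HasFDerivAt (fun p => (fderiv ℝ G p v).re)
      (Complex.reCLM ∘L (ContinuousLinearMap.apply ℝ ℂ v) ∘L fderiv ℝ (fderiv ℝ G) p) p :=
    Complex.reCLM.hasFDerivAt.comp p hD
  have hDim : HasFDerivAt (fun p => (fderiv ℝ G p v).im)
      (Complex.imCLM ∘L (ContinuousLinearMap.apply ℝ ℂ v) ∘L fderiv ℝ (fderiv ℝ G) p) p :=
    Complex.imCLM.hasFDerivAt.comp p hD
  have hFd : HasDerivAt F (deriv F ((G p).re ^ 2 + (G p).im ^ 2)) ((G p).re ^ 2 + (G p).im ^ 2) :=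
    (hF.differentiable (by norm_num) _).hasDerivAt
  have hs := (hre.pow 2).add (him.pow 2)
  have := (hFd.comp_hasFDerivAt p hs).mul ((hre.mul hDim).sub (him.mul hDre))
  have h2 : fderiv ℝ (angularForm F G v) p = _ := this.fderiv
  rw [h2]
  simp [wedge]
  ring

/-- `d(F(|w|²) Im(conj w dw)) = 2 (F + s F')(|w|²) du ∧ dv`, pulled back by `G`. -/
theorem fderiv_angularForm_sub {F : ℝ → ℝ} {G : V → ℂ} (hF : ContDiff ℝ 1 F)
    (hG : ContDiff ℝ 2 G) (u v : V) (p : V) :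
    fderiv ℝ (angularForm F G v) p u - fderiv ℝ (angularForm F G u) p v =
      2 * (F ((G p).re ^ 2 + (G p).im ^ 2) +
        ((G p).re ^ 2 + (G p).im ^ 2) * deriv F ((G p).re ^ 2 + (G p).im ^ 2)) *
        wedge (fderiv ℝ G p u) (fderiv ℝ G p v) := by
  -- By symmetry the second-derivative terms cancel, so G need only be C².
  have hsymm : fderiv ℝ (fderiv ℝ G) p u v = fderiv ℝ (fderiv ℝ G) p v u :=
    (hG.contDiffAt.isSymmSndFDerivAt (by simp)).eq u v
  rw [fderiv_angularForm hF hG, fderiv_angularForm hF hG, hsymm]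
  simp only [wedge]
  ring

end

/-- Green's formula for the pullback of `F(|w|²) Im(conj w dw)` on a rectangle. -/
theorem integral_wedge_rectangle {F : ℝ → ℝ} {G : ℝ × ℝ → ℂ} (hF : ContDiff ℝ 1 F)
    (hG : ContDiff ℝ 2 G) (a b c d : ℝ) :
    ∫ x in a..b, ∫ y in c..d, 2 * (F ((G (x, y)).re ^ 2 + (G (x, y)).im ^ 2) +
        ((G (x, y)).re ^ 2 + (G (x, y)).im ^ 2) *
          deriv F ((G (x, y)).re ^ 2 + (G (x, y)).im ^ 2)) *
        wedge (fderiv ℝ G (x, y) (1, 0)) (fderiv ℝ G (x, y) (0, 1)) =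
      (∫ x in a..b, angularForm F G (1, 0) (x, c)) - (∫ x in a..b, angularForm F G (1, 0) (x, d)) +
      ((∫ y in c..d, angularForm F G (0, 1) (b, y)) - ∫ y in c..d, angularForm F G (0, 1) (a, y))
      := by
  have hQ := contDiff_angularForm hF hG (0, 1)
  have hP := contDiff_angularForm hF hG (1, 0)
  have hP' : ContDiff ℝ 1 (fun p => -angularForm F G (1, 0) p) := hP.neg
  have e : ∀ p, fderiv ℝ (fun p => -angularForm F G (1, 0) p) p =
      -fderiv ℝ (angularForm F G (1, 0)) p := fun p => fderiv_fun_neg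
  -- Green's formula for P dx + Q dy is the divergence theorem for the field (Q, -P).
  have := integral2_divergence_prod_of_hasFDerivAt_off_countable (angularForm F G (0, 1))
    (fun p => -angularForm F G (1, 0) p) (fderiv ℝ (angularForm F G (0, 1)))
    (fderiv ℝ (fun p => -angularForm F G (1, 0) p)) a c b d ∅ countable_empty
    hQ.continuous.continuousOn hP'.continuous.continuousOn
    (fun p _ => (hQ.differentiable (by norm_num) p).hasFDerivAt)
    (fun p _ => (hP'.differentiable (by norm_num) p).hasFDerivAt)
    (((((hQ.continuous_fderiv (by norm_num)).clm_apply continuous_const).add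
      ((hP'.continuous_fderiv (by norm_num)).clm_apply continuous_const)).continuousOn).integrableOn_compact
        (isCompact_uIcc.prod isCompact_uIcc))
  simp only [e, neg_apply, ← sub_eq_add_neg, fderiv_angularForm_sub hF hG,
    intervalIntegral.integral_neg] at this
  rw [this]
  ring

theorem contDiff_polar (z₀ : ℂ) : ContDiff ℝ 2 (fun p : ℝ × ℝ => circleMap z₀ p.1 p.2) := by
  unfold circleMap
  have h1 : ContDiff ℝ 2 (fun p : ℝ × ℝ => (p.1 : ℂ)) := Complex.ofRealCLM.contDiff.comp contDiff_fst
  have h2 : ContDiff ℝ 2 (fun p : ℝ × ℝ => (p.2 : ℂ)) := Complex.ofRealCLM.contDiff.comp contDiff_snd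
  exact contDiff_const.add (h1.mul (h2.mul contDiff_const).cexp)

theorem fderiv_comp_polar {g : ℂ → ℂ} (hg : ContDiff ℝ 2 g) (z₀ : ℂ) (p v : ℝ × ℝ) :
    fderiv ℝ (fun p : ℝ × ℝ => g (circleMap z₀ p.1 p.2)) p v =
      fderiv ℝ g (circleMap z₀ p.1 p.2)
        ((v.1 + p.1 * v.2 * Complex.I) * Complex.exp (p.2 * Complex.I)) := by
  have h1 : HasFDerivAt (fun p : ℝ × ℝ => (p.1 : ℂ))
      (Complex.ofRealCLM ∘L ContinuousLinearMap.fst ℝ ℝ ℝ) p :=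
    Complex.ofRealCLM.hasFDerivAt.comp p hasFDerivAt_fst
  have h2 : HasFDerivAt (fun p : ℝ × ℝ => (p.2 : ℂ))
      (Complex.ofRealCLM ∘L ContinuousLinearMap.snd ℝ ℝ ℝ) p :=
    Complex.ofRealCLM.hasFDerivAt.comp p hasFDerivAt_snd
  have h3 : HasFDerivAt (fun p : ℝ × ℝ => circleMap z₀ p.1 p.2) _ p :=
    (h1.mul (h2.mul_const Complex.I).cexp).const_add z₀
  have h4 := ((hg.differentiable (by norm_num)
    (circleMap z₀ p.1 p.2)).hasFDerivAt).comp p h3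
  have h5 : fderiv ℝ (fun p : ℝ × ℝ => g (circleMap z₀ p.1 p.2)) p = _ := h4.fderiv
  rw [h5]
  simp only [ContinuousLinearMap.comp_apply]
  congr 1
  simp
  ring

/-- The polar frame is the basis (1, i) rotated by t, with its second vector scaled by r; the factor
r is the Jacobian of polar coordinates. -/
theorem wedge_map_polar (D : ℂ →L[ℝ] ℂ) (r t : ℝ) :
    wedge (D (Complex.exp (t * Complex.I))) (D (r * Complex.I * Complex.exp (t * Complex.I))) =
      r * wedge (D 1) (D Complex.I) := by
  have key : ∀ a b : ℝ, D (a + b * Complex.I) = a * D 1 + b * D Complex.I := by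
    intro a b
    have : (a + b * Complex.I : ℂ) = a • (1 : ℂ) + b • Complex.I := by simp
    rw [this, map_add, map_smul, map_smul]
    simp
  have e1 : Complex.exp (t * Complex.I) = (Real.cos t : ℝ) + (Real.sin t : ℝ) * Complex.I := by
    rw [Complex.exp_mul_I]; simp
  have e2 : r * Complex.I * Complex.exp (t * Complex.I) =
      ((-(r * Real.sin t) : ℝ) : ℂ) + ((r * Real.cos t : ℝ) : ℂ) * Complex.I := by
    rw [e1]; push_cast; ring_nf; simp; ring
  rw [e2, e1, key, key]
  simp only [wedge, Complex.add_re, Complex.add_im, Complex.re_ofReal_mul, Complex.im_ofReal_mul]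
  linear_combination (r * ((D 1).re * (D Complex.I).im - (D 1).im * (D Complex.I).re)) *
    Real.sin_sq_add_cos_sq t

theorem setIntegral_ball_eq_polar (z₀ : ℂ) {R : ℝ} (hR : 0 < R) {k : ℂ → ℝ} (hk : Continuous k) :
    ∫ z in Metric.ball z₀ R, k z =
      ∫ r in (0 : ℝ)..R, ∫ t in (-Real.pi)..Real.pi, r * k (circleMap z₀ r t) := by
  rw [← integral_indicator Metric.isOpen_ball.measurableSet,
    ← integral_add_left_eq_self _ z₀, ← Complex.integral_comp_polarCoord_symm]
  have h1 : ∀ p ∈ polarCoord.target, p.1 • (Metric.ball z₀ R).indicator k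
      (z₀ + Complex.polarCoord.symm p) =
      (Iio R ×ˢ univ).indicator (fun p : ℝ × ℝ => p.1 * k (circleMap z₀ p.1 p.2)) p := by
    intro p hp
    have hp1 : 0 < p.1 := hp.1
    have e : z₀ + Complex.polarCoord.symm p = circleMap z₀ p.1 p.2 := by
      rw [Complex.polarCoord_symm_apply, circleMap, Complex.exp_mul_I]; simp
    by_cases hpR : p.1 < R
    · rw [indicator_of_mem, indicator_of_mem, e, smul_eq_mul]
      · exact ⟨hpR, trivial⟩
      · simp [abs_of_pos hp1, hpR]
    · rw [indicator_of_notMem, indicator_of_notMem, smul_zero]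
      · exact fun h => hpR h.1
      · simpa [e, abs_of_pos hp1] using hpR
  rw [setIntegral_congr_fun polarCoord.open_target.measurableSet h1,
    setIntegral_indicator (measurableSet_Iio.prod MeasurableSet.univ)]
  have h2 : polarCoord.target ∩ Iio R ×ˢ univ = Ioo 0 R ×ˢ Ioo (-Real.pi) Real.pi := by
    rw [polarCoord_target, Set.prod_inter_prod, inter_univ, Ioi_inter_Iio]
  have hc : Continuous (fun p : ℝ × ℝ => p.1 * k (circleMap z₀ p.1 p.2)) :=
    continuous_fst.mul (hk.comp (contDiff_polar z₀).continuous)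
  rw [h2, Measure.volume_eq_prod, setIntegral_prod]
  · rw [intervalIntegral.integral_of_le hR.le, ← integral_Ioc_eq_integral_Ioo]
    congr 1 with r
    rw [intervalIntegral.integral_of_le (by linarith [Real.pi_pos]),
      ← integral_Ioc_eq_integral_Ioo]
  · exact (hc.continuousOn.integrableOn_compact (isCompact_Icc.prod isCompact_Icc)).mono_set
      (prod_mono Ioo_subset_Icc_self Ioo_subset_Icc_self)

/-- Green's formula for the pullback of `F(|w|²) Im(conj w dw)` on a disc. -/
theorem integral_wedge_ball {F : ℝ → ℝ} {g : ℂ → ℂ} (hF : ContDiff ℝ 1 F)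
    (hg : ContDiff ℝ 2 g) (z₀ : ℂ) {R : ℝ} (hR : 0 < R) :
    ∫ z in Metric.ball z₀ R, 2 * (F ((g z).re ^ 2 + (g z).im ^ 2) +
        ((g z).re ^ 2 + (g z).im ^ 2) * deriv F ((g z).re ^ 2 + (g z).im ^ 2)) *
        wedge (fderiv ℝ g z 1) (fderiv ℝ g z Complex.I) =
      ∫ t in (0 : ℝ)..2 * Real.pi, F ((g (circleMap z₀ R t)).re ^ 2 +
        (g (circleMap z₀ R t)).im ^ 2) * wedge (g (circleMap z₀ R t))
          (fderiv ℝ g (circleMap z₀ R t) (R * Complex.I * Complex.exp (t * Complex.I))) := by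
  have hs : Continuous (fun z => (g z).re ^ 2 + (g z).im ^ 2) :=
    ((Complex.continuous_re.comp hg.continuous).pow 2).add
      ((Complex.continuous_im.comp hg.continuous).pow 2)
  have hD : ∀ v, Continuous (fun z => fderiv ℝ g z v) := fun v =>
    (hg.continuous_fderiv (by norm_num)).clm_apply continuous_const
  rw [setIntegral_ball_eq_polar z₀ hR]
  swap
  · unfold wedge
    have := hD 1
    have := hD Complex.I
    have := hF.continuous.comp hs
    have := (hF.continuous_deriv (by norm_num)).comp hs
    fun_prop
  set G : ℝ × ℝ → ℂ := fun p => g (circleMap z₀ p.1 p.2) with hGdef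
  have hG : ContDiff ℝ 2 G := hg.comp (contDiff_polar z₀)
  have hGr : ∀ r t : ℝ, fderiv ℝ G (r, t) (1, 0) =
      fderiv ℝ g (circleMap z₀ r t) (Complex.exp (t * Complex.I)) := by
    intro r t; rw [fderiv_comp_polar hg]; simp
  have hGt : ∀ r t : ℝ, fderiv ℝ G (r, t) (0, 1) =
      fderiv ℝ g (circleMap z₀ r t) (r * Complex.I * Complex.exp (t * Complex.I)) := by
    intro r t; rw [fderiv_comp_polar hg]; simp
  have main := integral_wedge_rectangle hF hG 0 R (-Real.pi) Real.pi
  simp only [hGr, hGt, wedge_map_polar, angularForm] at main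
  -- In polar coordinates only one edge of the rectangle survives: r = 0 collapses to the centre,
  -- and t = -π, t = π are the same segment traversed in opposite directions.
  have e0 : ∀ t : ℝ, wedge (G (0, t)) (fderiv ℝ g (circleMap z₀ 0 t)
      ((0 : ℝ) * Complex.I * Complex.exp (t * Complex.I))) = 0 := by
    intro t; simp [wedge]
  have e1 : ∀ r : ℝ, circleMap z₀ r (-Real.pi) = circleMap z₀ r Real.pi := by
    intro r
    have := periodic_circleMap z₀ r (-Real.pi)
    rw [← this]; congr 1; ring
  have e2 : Complex.exp ((-Real.pi : ℝ) * Complex.I) = Complex.exp ((Real.pi : ℝ) * Complex.I) := by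
    have := periodic_circleMap 0 1 (-Real.pi)
    simp only [circleMap, Complex.ofReal_one, one_mul, zero_add] at this
    rw [← this]; congr 2; push_cast; ring
  have e3 : ∀ r : ℝ, G (r, -Real.pi) = G (r, Real.pi) := fun r => by simp only [hGdef, e1]
  simp only [e0, mul_zero, intervalIntegral.integral_zero, sub_zero, e1, e2, e3, sub_self,
    zero_add] at main
  have hper : Function.Periodic (fun t : ℝ => F ((g (circleMap z₀ R t)).re ^ 2 +
        (g (circleMap z₀ R t)).im ^ 2) * wedge (g (circleMap z₀ R t))
          (fderiv ℝ g (circleMap z₀ R t) (R * Complex.I * Complex.exp (t * Complex.I))))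
      (2 * Real.pi) := by
    intro t
    have h1 := periodic_circleMap z₀ R t
    have h2 := periodic_circleMap 0 1 t
    simp only [circleMap, Complex.ofReal_one, one_mul, zero_add] at h2
    simp only [h1, h2]
  -- Polar coordinates use angles from -π to π, winding numbers use 0 to 2π.
  have shift := hper.intervalIntegral_add_eq (-Real.pi) 0
  rw [show -Real.pi + 2 * Real.pi = Real.pi by ring, zero_add] at shift
  rw [← shift, ← main]
  refine intervalIntegral.integral_congr fun r _ => intervalIntegral.integral_congr fun t _ => ?_
  simp only [hGdef]
  ring

/-! ### Winding numbers -/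

/-- Rouché's argument: the quotient (γ' - w)/(γ - w) stays in the unit disc around 1, so its
principal logarithm is continuous and takes equal values at both ends. Adding it to a logarithm of γ
- w leaves the increment unchanged. -/
theorem HasWindingNumber.of_dist_lt {γ γ' : ℝ → ℂ} {w : ℂ} {n : ℤ} (h : HasWindingNumber γ w n)
    (hγ : ContinuousOn γ (Icc 0 (2 * Real.pi))) (hγ' : ContinuousOn γ' (Icc 0 (2 * Real.pi)))
    (hcl : γ (2 * Real.pi) = γ 0) (hcl' : γ' (2 * Real.pi) = γ' 0)
    (hd : ∀ t ∈ Icc 0 (2 * Real.pi), ‖γ' t - γ t‖ < ‖γ t - w‖) : HasWindingNumber γ' w n := by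
  obtain ⟨L, hLc, hLe, hLn⟩ := h
  have hne : ∀ t ∈ Icc 0 (2 * Real.pi), γ t - w ≠ 0 := fun t ht => by
    rw [← norm_pos_iff]; exact (norm_nonneg _).trans_lt (hd t ht)
  have hq : ∀ t ∈ Icc 0 (2 * Real.pi), (γ' t - w) / (γ t - w) ∈ Complex.slitPlane := by
    intro t ht
    have h1 : (γ' t - w) / (γ t - w) = 1 + (γ' t - γ t) / (γ t - w) := by
      field_simp [hne t ht]; ring
    rw [h1]
    apply Complex.mem_slitPlane_of_norm_lt_one
    rw [norm_div, div_lt_one (norm_pos_iff.2 (hne t ht))]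
    exact hd t ht
  refine ⟨fun t => L t + Complex.log ((γ' t - w) / (γ t - w)), ?_, ?_, ?_⟩
  · exact hLc.add (((hγ'.sub continuousOn_const).div (hγ.sub continuousOn_const) hne).clog hq)
  · intro t ht
    rw [Complex.exp_add, hLe t ht, Complex.exp_log (Complex.slitPlane_ne_zero (hq t ht))]
    field_simp [hne t ht]
  · simp only [hcl, hcl']
    rw [← hLn]; ring

/-- The winding number is the integral of the angular form. -/
theorem HasWindingNumber.integral_wedge {γ γ' : ℝ → ℂ} {w : ℂ} {n : ℤ}
    (h : HasWindingNumber γ w n) (hγ : ∀ t, HasDerivAt γ (γ' t) t) (hγ' : Continuous γ')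
    (hne : ∀ t, γ t ≠ w) :
    ∫ t in (0 : ℝ)..2 * Real.pi, wedge (γ t - w) (γ' t) / ((γ t - w).re ^ 2 + (γ t - w).im ^ 2) =
      n * (2 * Real.pi) := by
  obtain ⟨L, hLc, hLe, hLn⟩ := h
  have hne' : ∀ t, γ t - w ≠ 0 := fun t => sub_ne_zero.2 (hne t)
  have hγc : Continuous γ := continuous_iff_continuousAt.2 fun t => (hγ t).continuousAt
  have hd : ∀ t ∈ Ioo 0 (2 * Real.pi), HasDerivAt L (γ' t / (γ t - w)) t := by
    intro t ht
    have hmem : Icc 0 (2 * Real.pi) ∈ nhds t := Icc_mem_nhds ht.1 ht.2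
    have hLt : ContinuousAt L t := hLc.continuousAt hmem
    -- L is only known to be continuous. Near t the imaginary part of L s - L t is smaller than π,
    -- so L agrees there with the principal logarithm of the quotient plus L t, which is
    -- differentiable.
    have h1 : HasDerivAt (fun s => Complex.log ((γ s - w) / (γ t - w)) + L t)
        (γ' t / (γ t - w)) t := by
      have h2 : HasDerivAt (fun s => (γ s - w) / (γ t - w)) (γ' t / (γ t - w)) t :=
        ((hγ t).sub_const w).div_const _
      have h3 := (h2.clog_real (by rw [div_self (hne' t)]; exact Complex.one_mem_slitPlane)).add_const
        (L t)
      rwa [div_self (hne' t), div_one] at h3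
    refine h1.congr_of_eventuallyEq ?_
    have h4 : ∀ᶠ s in nhds t, ‖L s - L t‖ < Real.pi := by
      have := Metric.continuousAt_iff'.1 hLt Real.pi Real.pi_pos
      simpa [dist_eq_norm] using this
    filter_upwards [h4, hmem] with s hs hs'
    have him : |(L s - L t).im| < Real.pi := (Complex.abs_im_le_norm _).trans_lt hs
    rw [← hLe s hs', ← hLe t (mem_of_mem_nhds hmem), ← Complex.exp_sub,
      Complex.log_exp (abs_lt.1 him).1 (abs_lt.1 him).2.le]
    ring
  have hcont : Continuous fun t => γ' t / (γ t - w) :=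
    hγ'.div (hγc.sub continuous_const) hne'
  have key := intervalIntegral.integral_eq_sub_of_hasDerivAt_of_le
    (by positivity) hLc hd (hcont.intervalIntegrable 0 (2 * Real.pi))
  rw [hLn] at key
  have h5 := congrArg Complex.imCLM key
  rw [← ContinuousLinearMap.intervalIntegral_comp_comm _ (hcont.intervalIntegrable 0 (2 * Real.pi))]
    at h5
  have h6 : Complex.imCLM (n * (2 * Real.pi * Complex.I)) = n * (2 * Real.pi) := by
    simp
  rw [← h6, ← h5]
  refine intervalIntegral.integral_congr fun t _ => ?_
  simp only [wedge, Complex.imCLM_apply, Complex.div_im, Complex.normSq_apply]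
  ring

/-! ### Radial weights and the degree formula -/

/-- The primitive appearing in the radial form. -/
noncomputable def radialMean (σ : ℝ → ℝ) (s : ℝ) : ℝ :=
  if s = 0 then 1 / 2 else (∫ u in (0 : ℝ)..s, σ u) / (2 * s)

theorem radialMean_of_lt {σ : ℝ → ℝ} {δ : ℝ} (h1 : ∀ s < δ, σ s = 1) (hδ : 0 < δ) {s : ℝ}
    (hs : s < δ) : radialMean σ s = 1 / 2 := by
  unfold radialMean
  split_ifs with h
  · rfl
  · have : ∫ u in (0 : ℝ)..s, σ u = ∫ u in (0 : ℝ)..s, (1 : ℝ) := by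
      refine intervalIntegral.integral_congr fun u hu => h1 u ?_
      exact hu.2.trans_lt (max_lt hδ hs)
    rw [this]
    field_simp
    simp

/-- Off 0, F = `radialMean σ` satisfies s F(s) = ½ ∫₀ˢ σ; differentiate. Below δ it is constant, and
the formula also gives 0, including at s = 0 by the convention x / 0 = 0. -/
theorem hasDerivAt_radialMean {σ : ℝ → ℝ} (hσ : Continuous σ) {δ : ℝ} (h1 : ∀ s < δ, σ s = 1)
    (hδ : 0 < δ) (s : ℝ) :
    HasDerivAt (radialMean σ) ((σ s / 2 - radialMean σ s) / s) s := by
  rcases lt_or_ge s δ with hs | hs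
  · rw [radialMean_of_lt h1 hδ hs, h1 s hs, sub_self, zero_div]
    refine (hasDerivAt_const s (1 / 2 : ℝ)).congr_of_eventuallyEq ?_
    filter_upwards [Iio_mem_nhds hs] with u hu using radialMean_of_lt h1 hδ hu
  · have hs0 : s ≠ 0 := (hδ.trans_le hs).ne'
    have h2 : HasDerivAt (fun s => (∫ u in (0 : ℝ)..s, σ u)) (σ s) s :=
      intervalIntegral.integral_hasDerivAt_right (hσ.intervalIntegrable _ _)
        (hσ.stronglyMeasurableAtFilter _ _) hσ.continuousAt
    have h3 := h2.div ((hasDerivAt_id s).const_mul 2) (by simpa using hs0)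
    have h4 : HasDerivAt (radialMean σ) _ s := h3.congr_of_eventuallyEq (by
      filter_upwards [isOpen_ne.mem_nhds hs0] with u hu
      simp [radialMean, show u ≠ 0 from hu])
    convert! h4 using 1
    simp only [radialMean, if_neg hs0]
    simp
    field_simp

theorem contDiff_radialMean {σ : ℝ → ℝ} (hσ : Continuous σ) {δ : ℝ} (h1 : ∀ s < δ, σ s = 1)
    (hδ : 0 < δ) : ContDiff ℝ 1 (radialMean σ) := by
  have hd := hasDerivAt_radialMean hσ h1 hδ
  rw [contDiff_one_iff_deriv]
  refine ⟨fun s => (hd s).differentiableAt, ?_⟩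
  have e : deriv (radialMean σ) = fun s => (σ s / 2 - radialMean σ s) / s :=
    funext fun s => (hd s).deriv
  rw [e, continuous_iff_continuousAt]
  intro s
  rcases lt_or_ge s δ with hs | hs
  · refine (continuousAt_const (y := (0 : ℝ))).congr ?_
    filter_upwards [Iio_mem_nhds hs] with u hu
    rw [radialMean_of_lt h1 hδ hu, h1 u hu, sub_self, zero_div]
  · exact ((hσ.continuousAt.div_const 2).sub (hd s).continuousAt).div continuousAt_id
      (hδ.trans_le hs).ne'

/-- Degree formula on a disc: if `g` maps the boundary circle to a curve with winding number one
around `w₀` which stays at distance at least `√m` from `w₀`, then integrating the Jacobian against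
a radial weight supported in the disc of radius `√m` gives the integral of that weight. -/
theorem integral_radial_wedge {g : ℂ → ℂ} (hg : ContDiff ℝ 2 g) {z₀ w₀ : ℂ} {R m δ : ℝ}
    (hR : 0 < R) (hδ : 0 < δ) (hm : 0 < m)
    {σ : ℝ → ℝ} (hσ : Continuous σ) (h1 : ∀ s < δ, σ s = 1) (h0 : ∀ s, m ≤ s → σ s = 0)
    (hw : HasWindingNumber (fun t => g (circleMap z₀ R t)) w₀ 1)
    (hfar : ∀ t, m ≤ (g (circleMap z₀ R t) - w₀).re ^ 2 + (g (circleMap z₀ R t) - w₀).im ^ 2) :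
    ∫ z in Metric.ball z₀ R, σ ((g z - w₀).re ^ 2 + (g z - w₀).im ^ 2) *
        wedge (fderiv ℝ g z 1) (fderiv ℝ g z Complex.I) = Real.pi * ∫ s in (0 : ℝ)..m, σ s := by
  have hF := contDiff_radialMean hσ h1 hδ
  have hd := hasDerivAt_radialMean hσ h1 hδ
  have hg' : ContDiff ℝ 2 (fun z => g z - w₀) := hg.sub contDiff_const
  have green := integral_wedge_ball hF hg' z₀ hR
  -- F was chosen to solve 2 (s F)' = σ, so the area integrand in Green's formula becomes σ times
  -- the Jacobian.
  have e1 : ∀ s, 2 * (radialMean σ s + s * deriv (radialMean σ) s) = σ s := by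
    intro s
    rw [(hd s).deriv]
    rcases eq_or_ne s 0 with rfl | hs
    · rw [radialMean_of_lt h1 hδ hδ, h1 0 hδ]; norm_num
    · field_simp; ring
  simp only [e1, fderiv_sub_const] at green
  rw [green]
  -- Beyond m the weight has no mass left, so F is a constant over s and the boundary form is a
  -- constant multiple of dθ; its integral is a winding number.
  have e2 : ∀ s, m ≤ s → radialMean σ s = ((∫ u in (0 : ℝ)..m, σ u) / 2) / s := by
    intro s hs
    have hs0 : s ≠ 0 := (hm.trans_le hs).ne'
    have : ∫ u in (0 : ℝ)..s, σ u = ∫ u in (0 : ℝ)..m, σ u := by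
      rw [← intervalIntegral.integral_add_adjacent_intervals (hσ.intervalIntegrable 0 m)
        (hσ.intervalIntegrable m s), add_eq_left]
      refine (intervalIntegral.integral_congr (g := fun _ => (0 : ℝ)) fun u hu => h0 u ?_).trans
        (by simp)
      rw [uIcc_of_le hs] at hu
      exact hu.1
    simp only [radialMean, if_neg hs0, this]
    field_simp
  set γ' : ℝ → ℂ := fun t => fderiv ℝ g (circleMap z₀ R t)
    (R * Complex.I * Complex.exp (t * Complex.I)) with hγ'
  have hcd : ∀ t, HasDerivAt (fun t => g (circleMap z₀ R t)) (γ' t) t := by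
    intro t
    have a1 := ((hg.differentiable (by norm_num)) (circleMap z₀ R t)).hasFDerivAt
    have a2 := a1.comp_hasDerivAt t (hasDerivAt_circleMap z₀ R t)
    convert! a2 using 1
    simp only [hγ', circleMap, zero_add]
    congr 1; ring
  have hγ'c : Continuous γ' := by
    have a1 : Continuous fun t => fderiv ℝ g (circleMap z₀ R t) :=
      (hg.continuous_fderiv (by norm_num)).comp (continuous_circleMap z₀ R)
    exact a1.clm_apply (by fun_prop)
  have hne : ∀ t, g (circleMap z₀ R t) ≠ w₀ := by
    intro t ht
    have := hfar t
    rw [ht] at this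
    simp at this
    linarith
  have wind := hw.integral_wedge hcd hγ'c hne
  have e3 : ∀ t, radialMean σ ((g (circleMap z₀ R t) - w₀).re ^ 2 +
      (g (circleMap z₀ R t) - w₀).im ^ 2) * wedge (g (circleMap z₀ R t) - w₀) (γ' t) =
      ((∫ u in (0 : ℝ)..m, σ u) / 2) * (wedge (g (circleMap z₀ R t) - w₀) (γ' t) /
        ((g (circleMap z₀ R t) - w₀).re ^ 2 + (g (circleMap z₀ R t) - w₀).im ^ 2)) := by
    intro t
    rw [e2 _ (hfar t)]; ring
  simp only [hγ'] at e3 wind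
  simp only [e3]
  rw [intervalIntegral.integral_const_mul, wind]
  push_cast
  ring

/-! ### Mollification -/

open scoped Convolution

/-- The mollification of `u` by the normalized bump function `ρ`. -/
noncomputable def mollify (ρ : ContDiffBump (0 : ℂ)) (u : ℂ → ℂ) : ℂ → ℂ :=
  ρ.normed volume ⋆[ContinuousLinearMap.lsmul ℝ ℝ, volume] u

theorem contDiff_mollify (ρ : ContDiffBump (0 : ℂ)) {u : ℂ → ℂ} (hu : Integrable u) :
    ContDiff ℝ ∞ (mollify ρ u) :=
  ρ.hasCompactSupport_normed.contDiff_convolution_left _ ρ.contDiff_normed hu.locallyIntegrable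

/-- Mollification commutes with weak derivatives, away from the boundary. -/
theorem HasWeakPartial.fderiv_mollify {X : Set ℂ} (hX : IsOpen X) {f g : ℂ → ℂ} {v : ℂ}
    (h : HasWeakPartial X f v g) (hf : IntegrableOn f X) (ρ : ContDiffBump (0 : ℂ)) {z : ℂ}
    (hz : Metric.closedBall z ρ.rOut ⊆ X) :
    fderiv ℝ (mollify ρ (X.indicator f)) z v = mollify ρ (X.indicator g) z := by
  have hfi : Integrable (X.indicator f) := hf.integrable_indicator hX.measurableSet
  have hρ : ContDiff ℝ ∞ (ρ.normed volume) := ρ.contDiff_normed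
  have hρ1 : ContDiff ℝ 1 (ρ.normed volume) := ρ.contDiff_normed
  have hρc := ρ.hasCompactSupport_normed (μ := volume)
  have h1 := hρc.hasFDerivAt_convolution_left (ContinuousLinearMap.lsmul ℝ ℝ) hρ1
    hfi.locallyIntegrable z
  have h2 : fderiv ℝ (mollify ρ (X.indicator f)) z = _ := h1.fderiv
  have hex : ConvolutionExistsAt (fderiv ℝ (ρ.normed volume)) (X.indicator f) z
      ((ContinuousLinearMap.lsmul ℝ ℝ : ℝ →L[ℝ] ℂ →L[ℝ] ℂ).precompL ℂ) volume :=
    (hρc.fderiv ℝ).convolutionExists_left _ (hρ1.continuous_fderiv (by norm_num))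
      hfi.locallyIntegrable z
  rw [h2, convolution, ContinuousLinearMap.integral_apply hex]
  simp only [ContinuousLinearMap.precompL_apply, ContinuousLinearMap.lsmul_apply]
  rw [mollify, convolution]
  simp only [ContinuousLinearMap.lsmul_apply]
  -- Substituting y = z - t turns the kernel into the test function y ↦ ρ(z - y), supported in the
  -- closed ball around z that lies in X.
  rw [← integral_sub_left_eq_self (fun t => fderiv ℝ (ρ.normed volume) t v •
      X.indicator f (z - t)) volume z,
    ← integral_sub_left_eq_self (fun t => ρ.normed volume t • X.indicator g (z - t)) volume z]
  simp only [sub_sub_cancel]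
  set φ : ℂ → ℝ := fun y => ρ.normed volume (z - y) with hφ
  have hφs : ContDiff ℝ ∞ φ := hρ.comp (contDiff_const.sub contDiff_id)
  have hsupp : tsupport φ ⊆ Metric.closedBall z ρ.rOut := by
    refine closure_minimal (fun y hy => ?_) Metric.isClosed_closedBall
    have : z - y ∈ Function.support (ρ.normed volume) := hy
    rw [ρ.support_normed_eq] at this
    rw [Metric.mem_closedBall, dist_comm, dist_eq_norm]
    exact (mem_ball_zero_iff.1 this).le
  have hcomp : HasCompactSupport φ :=
    (isCompact_closedBall z ρ.rOut).of_isClosed_subset (isClosed_tsupport _) hsupp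
  have hder : ∀ y, fderiv ℝ φ y v = -fderiv ℝ (ρ.normed volume) (z - y) v := by
    intro y
    have a1 : HasFDerivAt (ρ.normed volume) (fderiv ℝ (ρ.normed volume) (z - y)) (z - y) :=
      (hρ1.differentiable (by norm_num) _).hasFDerivAt
    have a2 : HasFDerivAt (fun y : ℂ => z - y) (-ContinuousLinearMap.id ℝ ℂ) y :=
      (hasFDerivAt_id y).const_sub z
    have a3 : fderiv ℝ φ y = _ := (a1.comp y a2).fderiv
    rw [a3]; simp
  have key := h.integral_eq φ hφs hcomp (hsupp.trans hz)
  have i1 : ∫ y, fderiv ℝ (ρ.normed volume) (z - y) v • X.indicator f y =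
      - ∫ y in X, (fderiv ℝ φ y v) • f y := by
    rw [← integral_neg, ← integral_indicator hX.measurableSet]
    congr 1 with y
    by_cases hy : y ∈ X <;> simp [hy, hder]
  have i2 : ∫ y, ρ.normed volume (z - y) • X.indicator g y = ∫ y in X, φ y • g y := by
    rw [← integral_indicator hX.measurableSet]
    congr 1 with y
    by_cases hy : y ∈ X <;> simp [hy, hφ]
  rw [i1, i2, key, neg_neg]

theorem lintegral_sq_le_of_isProbabilityMeasure {α : Type*} [MeasurableSpace α] (P : Measure α)
    [IsProbabilityMeasure P] {v : α → ℝ≥0∞} (hv : AEMeasurable v P) :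
    (∫⁻ t, v t ∂P) ^ 2 ≤ ∫⁻ t, v t ^ 2 ∂P := by
  have := ENNReal.lintegral_mul_le_Lp_mul_Lq P (Real.HolderConjugate.two_two) hv
    (aemeasurable_const (b := (1 : ℝ≥0∞)))
  simp only [Pi.mul_apply, mul_one, ENNReal.one_rpow, lintegral_one, measure_univ] at this
  calc (∫⁻ t, v t ∂P) ^ 2 ≤ ((∫⁻ t, v t ^ (2 : ℝ) ∂P) ^ (1 / 2 : ℝ)) ^ 2 := by gcongr
    _ = ∫⁻ t, v t ^ 2 ∂P := by
      rw [← ENNReal.rpow_natCast, ← ENNReal.rpow_mul]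
      norm_num

/-- The kernel is a probability density, so this is Jensen's inequality for the square, at a single
point. -/
theorem enorm_mollify_sq_le (ρ : ContDiffBump (0 : ℂ)) {u : ℂ → ℂ} (hu : Measurable u) (z : ℂ) :
    ‖mollify ρ u z‖ₑ ^ 2 ≤ ∫⁻ t, ENNReal.ofReal (ρ.normed volume t) * ‖u (z - t)‖ₑ ^ 2 := by
  have hm : Measurable fun t => ENNReal.ofReal (ρ.normed volume t) :=
    (ρ.continuous_normed).measurable.ennreal_ofReal
  have hvm : Measurable fun t => ‖u (z - t)‖ₑ :=
    (hu.comp (measurable_const.sub measurable_id)).enorm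
  let P : Measure ℂ := volume.withDensity fun t => ENNReal.ofReal (ρ.normed volume t)
  have : IsProbabilityMeasure P := by
    refine ⟨?_⟩
    rw [withDensity_apply _ MeasurableSet.univ, Measure.restrict_univ,
      ← ofReal_integral_eq_lintegral_ofReal ρ.integrable_normed
        (Filter.Eventually.of_forall ρ.nonneg_normed), ρ.integral_normed, ENNReal.ofReal_one]
  have h1 : ‖mollify ρ u z‖ₑ ≤ ∫⁻ t, ‖u (z - t)‖ₑ ∂P := by
    rw [lintegral_withDensity_eq_lintegral_mul _ hm hvm]
    refine (enorm_integral_le_lintegral_enorm _).trans (lintegral_mono fun t => ?_)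
    simp only [ContinuousLinearMap.lsmul_apply, Pi.mul_apply, enorm_smul]
    rw [Real.enorm_eq_ofReal (ρ.nonneg_normed t)]
  calc ‖mollify ρ u z‖ₑ ^ 2 ≤ (∫⁻ t, ‖u (z - t)‖ₑ ∂P) ^ 2 := by gcongr
    _ ≤ ∫⁻ t, ‖u (z - t)‖ₑ ^ 2 ∂P := lintegral_sq_le_of_isProbabilityMeasure P hvm.aemeasurable
    _ = _ := by rw [lintegral_withDensity_eq_lintegral_mul _ hm (hvm.pow_const 2)]; rfl

/-- Jensen's inequality for mollifications. -/
theorem setLIntegral_enorm_mollify_sq_le (ρ : ContDiffBump (0 : ℂ)) {u : ℂ → ℂ}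
    (hu : AEStronglyMeasurable u volume) {A B : Set ℂ} (hA : MeasurableSet A)
    (hB : MeasurableSet B) (hAB : ∀ z ∈ A, Metric.ball z ρ.rOut ⊆ B) :
    ∫⁻ z in A, ‖mollify ρ u z‖ₑ ^ 2 ≤ ∫⁻ z in B, ‖u z‖ₑ ^ 2 := by
  wlog hum : Measurable u generalizing u
  · have e := hu.ae_eq_mk
    have e1 : mollify ρ u = mollify ρ (hu.mk u) :=
      convolution_congr _ (Filter.EventuallyEq.refl _ _) e
    have e2 : ∫⁻ z in B, ‖u z‖ₑ ^ 2 = ∫⁻ z in B, ‖hu.mk u z‖ₑ ^ 2 := by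
      refine lintegral_congr_ae (ae_restrict_of_ae ?_)
      filter_upwards [e] with z hz
      rw [hz]
    rw [e1, e2]
    exact this hu.stronglyMeasurable_mk.aestronglyMeasurable hu.stronglyMeasurable_mk.measurable
  have hm : Measurable fun t => ENNReal.ofReal (ρ.normed volume t) :=
    (ρ.continuous_normed).measurable.ennreal_ofReal
  calc ∫⁻ z in A, ‖mollify ρ u z‖ₑ ^ 2
      ≤ ∫⁻ z in A, ∫⁻ t, ENNReal.ofReal (ρ.normed volume t) * ‖u (z - t)‖ₑ ^ 2 :=
        lintegral_mono fun z => enorm_mollify_sq_le ρ hum z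
    _ = ∫⁻ t, ∫⁻ z in A, ENNReal.ofReal (ρ.normed volume t) * ‖u (z - t)‖ₑ ^ 2 := by
        refine lintegral_lintegral_swap (Measurable.aemeasurable ?_)
        exact (hm.comp measurable_snd).mul
          ((hum.comp (measurable_fst.sub measurable_snd)).enorm.pow_const 2)
    _ ≤ ∫⁻ t, ENNReal.ofReal (ρ.normed volume t) * ∫⁻ z in B, ‖u z‖ₑ ^ 2 := by
        refine lintegral_mono fun t => ?_
        rw [lintegral_const_mul _
          (show Measurable fun z => ‖u (z - t)‖ₑ ^ 2 from
            (hum.comp (measurable_id.sub_const t)).enorm.pow_const 2)]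
        -- Only shifts t in the support of the kernel count, and those carry A into B.
        by_cases ht : t ∈ Metric.ball (0 : ℂ) ρ.rOut
        · gcongr ENNReal.ofReal (ρ.normed volume t) * ?_
          rw [← lintegral_indicator hA, ← lintegral_indicator hB,
            ← lintegral_sub_right_eq_self (B.indicator fun z => ‖u z‖ₑ ^ 2) t]
          refine lintegral_mono fun z => ?_
          by_cases hz : z ∈ A
          · have : z - t ∈ B := hAB z hz (by simpa using ht)
            simp [hz, this]
          · simp [hz]
        · rw [← ρ.support_normed_eq (μ := volume), Function.notMem_support] at ht
          simp [ht]
    _ = ∫⁻ z in B, ‖u z‖ₑ ^ 2 := by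
        rw [lintegral_mul_const _ hm,
          ← ofReal_integral_eq_lintegral_ofReal ρ.integrable_normed
            (Filter.Eventually.of_forall ρ.nonneg_normed), ρ.integral_normed, ENNReal.ofReal_one,
          one_mul]

/-! ### Classical derivatives and the energy of a conformal map -/

/-- A classical derivative is a weak derivative. -/
theorem HasWeakPartial.of_contDiffOn {X : Set ℂ} (hX : IsOpen X) {f : ℂ → ℂ}
    (hf : ContDiffOn ℝ 1 f X) (v : ℂ) : HasWeakPartial X f v (fun z => fderiv ℝ f z v) := by
  have hf' : ContinuousOn (fun z => fderiv ℝ f z v) X :=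
    (hf.continuousOn_fderiv_of_isOpen hX le_rfl).clm_apply continuousOn_const
  refine ⟨hf.continuousOn.locallyIntegrableOn hX.measurableSet,
    hf'.locallyIntegrableOn hX.measurableSet, fun φ hφ hc hs => ?_⟩
  have int : ∀ (ψ : ℂ → ℝ) (u : ℂ → ℂ), Continuous ψ → Function.support ψ ⊆ tsupport φ →
      ContinuousOn u X → Integrable (fun z => ψ z • u z) := by
    intro ψ u hψ hψs hu
    refine IntegrableOn.integrable_of_forall_notMem_eq_zero (s := tsupport φ)
      ((hψ.continuousOn.smul (hu.mono hs)).integrableOn_compact hc) fun z hz => ?_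
    rw [Function.notMem_support.1 fun h => hz (hψs h), zero_smul]
  have hdφ : Continuous fun z => fderiv ℝ φ z v :=
    (hφ.continuous_fderiv (by simp)).clm_apply continuous_const
  have hsd : Function.support (fun z => fderiv ℝ φ z v) ⊆ tsupport φ := by
    intro z hz
    refine support_fderiv_subset ℝ (fun h => hz ?_)
    change fderiv ℝ φ z v = 0
    rw [h]; simp
  have key := integral_smul_fderiv_eq_neg_fderiv_smul_of_integrable (μ := (volume : Measure ℂ))
    (f := φ) (g := f) (v := v) (int _ _ hdφ hsd hf.continuousOn)
    (int _ _ hφ.continuous (subset_tsupport φ) hf')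
    (int _ _ hφ.continuous (subset_tsupport φ) hf.continuousOn)
    (fun z _ => hφ.differentiable (by simp) z)
    (fun z hz => ((hf z (hs hz)).contDiffAt (hX.mem_nhds (hs hz))).differentiableAt (by norm_num))
  rw [setIntegral_eq_integral_of_forall_compl_eq_zero fun z hz => ?_,
    setIntegral_eq_integral_of_forall_compl_eq_zero fun z hz => ?_, key, neg_neg]
  · rw [image_eq_zero_of_notMem_tsupport fun hz' => hz (hs hz'), zero_smul]
  · rw [Function.notMem_support.1 fun hz' => hz (hs (hsd hz')), zero_smul]

theorem det_complex_smul_one (c : ℂ) : (c • (1 : ℂ →L[ℝ] ℂ)).det = ‖c‖ ^ 2 := by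
  have : ((c • (1 : ℂ →L[ℝ] ℂ) : ℂ →L[ℝ] ℂ) : ℂ →ₗ[ℝ] ℂ) = Algebra.lmul ℝ ℂ c := by
    ext
    simp
  rw [ContinuousLinearMap.det, this, ← Algebra.norm_apply, Algebra.norm_complex_apply,
    Complex.normSq_eq_norm_sq]

/-- The Dirichlet energy of a conformal map is twice the area of its image. -/
theorem IsConformalOnto.dirichletEnergy_eq {X Y : Set ℂ} (hX : IsOpen X) {h : ℂ → ℂ}
    (hh : IsConformalOnto h X Y) : dirichletEnergy X h = 2 * volume Y := by
  have hc : ContDiffOn ℝ 1 h X := (hh.differentiableOn.contDiffOn hX (n := 1)).restrict_scalars ℝ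
  have hd : ∀ z ∈ X, HasFDerivAt h (deriv h z • (1 : ℂ →L[ℝ] ℂ)) z := fun z hz =>
    ((hh.differentiableOn z hz).differentiableAt (hX.mem_nhds hz)).hasDerivAt.complexToReal_fderiv
  rw [_root_.dirichletEnergy_eq hX (HasWeakPartial.of_contDiffOn hX hc 1)
    (HasWeakPartial.of_contDiffOn hX hc Complex.I), ← hh.bijOn.image_eq,
    ← lintegral_abs_det_fderiv_eq_addHaar_image volume hX.measurableSet
      (fun z hz => (hd z hz).hasFDerivWithinAt) hh.bijOn.injOn,
    ← lintegral_const_mul' _ _ (by simp)]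
  refine setLIntegral_congr_fun hX.measurableSet fun z hz => ?_
  simp only [(hd z hz).fderiv, det_complex_smul_one, abs_pow, abs_norm]
  rw [ENNReal.ofReal_pow (norm_nonneg _), ofReal_norm]
  have hI : ‖Complex.I‖ₑ = 1 := by rw [← ofReal_norm]; simp
  simp [enorm_mul, hI, two_mul]

/-! ### Energy = twice the Jacobian plus the Cauchy-Riemann defect -/

/-- Expand the last square: its cross term 2 Re(conj a · i b) is -2 Im(conj a · b). With a = g_x and
b = g_y, `wedge a b` is the Jacobian. -/
theorem norm_sq_add_norm_sq_eq (a b : ℂ) :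
    ‖a‖ ^ 2 + ‖b‖ ^ 2 = 2 * wedge a b + ‖a + Complex.I * b‖ ^ 2 := by
  simp only [← Complex.normSq_eq_norm_sq, Complex.normSq_apply, wedge]
  simp
  ring

theorem enorm_sq_eq_ofReal (a : ℂ) : ‖a‖ₑ ^ 2 = ENNReal.ofReal (‖a‖ ^ 2) := by
  rw [ENNReal.ofReal_pow (norm_nonneg _), ofReal_norm]

theorem mollify_add_const_mul (ρ : ContDiffBump (0 : ℂ)) {u v : ℂ → ℂ} (hu : Integrable u)
    (hv : Integrable v) (c : ℂ) (z : ℂ) :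
    mollify ρ (fun z => u z + c * v z) z = mollify ρ u z + c * mollify ρ v z := by
  have ex : ∀ w : ℂ → ℂ, Integrable w → ConvolutionExistsAt (ρ.normed volume) w z
      (ContinuousLinearMap.lsmul ℝ ℝ) volume := fun w hw =>
    ρ.hasCompactSupport_normed.convolutionExists_left _ ρ.continuous_normed
      hw.locallyIntegrable z
  have e1 := (ex u hu).distrib_add (ex _ (hv.const_mul c))
  change mollify ρ (u + fun z => c * v z) z = _
  rw [mollify, e1]
  congr 1
  simp only [mollify, convolution, ContinuousLinearMap.lsmul_apply]
  rw [← integral_const_mul]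
  congr 1 with t
  simp only [Complex.real_smul]
  ring

/-- Energy identity for smooth maps of a disc with boundary winding number one. -/
theorem lintegral_radial_energy {g : ℂ → ℂ} (hg : ContDiff ℝ 2 g) {z₀ w₀ : ℂ} {R m δ : ℝ}
    (hR : 0 < R) (hδ : 0 < δ) (hm : 0 < m)
    {σ : ℝ → ℝ} (hσ : Continuous σ) (hσ0 : ∀ s, 0 ≤ σ s) (h1 : ∀ s < δ, σ s = 1)
    (h0 : ∀ s, m ≤ s → σ s = 0)
    (hw : HasWindingNumber (fun t => g (circleMap z₀ R t)) w₀ 1)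
    (hfar : ∀ t, m ≤ ‖g (circleMap z₀ R t) - w₀‖ ^ 2) :
    ∫⁻ z in Metric.ball z₀ R, ENNReal.ofReal (σ (‖g z - w₀‖ ^ 2)) *
        (‖fderiv ℝ g z 1‖ₑ ^ 2 + ‖fderiv ℝ g z Complex.I‖ₑ ^ 2) =
      ENNReal.ofReal (2 * Real.pi * ∫ s in (0 : ℝ)..m, σ s) +
      ∫⁻ z in Metric.ball z₀ R, ENNReal.ofReal (σ (‖g z - w₀‖ ^ 2)) *
        ‖fderiv ℝ g z 1 + Complex.I * fderiv ℝ g z Complex.I‖ₑ ^ 2 := by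
  have hns : ∀ a : ℂ, ‖a‖ ^ 2 = a.re ^ 2 + a.im ^ 2 := fun a => by
    rw [← Complex.normSq_eq_norm_sq, Complex.normSq_apply]; ring
  have hdeg := integral_radial_wedge hg hR hδ hm hσ h1 h0 hw (fun t => by rw [← hns]; exact hfar t)
  simp only [← hns] at hdeg
  have hgc := hg.continuous
  have hD1 : Continuous fun z => fderiv ℝ g z 1 :=
    (hg.continuous_fderiv (by norm_num)).clm_apply continuous_const
  have hDI : Continuous fun z => fderiv ℝ g z Complex.I :=
    (hg.continuous_fderiv (by norm_num)).clm_apply continuous_const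
  have hin : ∀ k : ℂ → ℝ, Continuous k → IntegrableOn k (Metric.ball z₀ R) := fun k hk =>
    (hk.continuousOn.integrableOn_compact (isCompact_closedBall z₀ R)).mono_set
      Metric.ball_subset_closedBall
  have hconv : ∀ (k : ℂ → ℝ), Continuous k → (∀ z, 0 ≤ k z) →
      ∫⁻ z in Metric.ball z₀ R, ENNReal.ofReal (k z) =
        ENNReal.ofReal (∫ z in Metric.ball z₀ R, k z) := fun k hk hk0 =>
    (ofReal_integral_eq_lintegral_ofReal (hin k hk) (Filter.Eventually.of_forall hk0)).symm
  have cσ : Continuous fun z => σ (‖g z - w₀‖ ^ 2) := by fun_prop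
  have c1 : Continuous fun z => σ (‖g z - w₀‖ ^ 2) *
      (‖fderiv ℝ g z 1‖ ^ 2 + ‖fderiv ℝ g z Complex.I‖ ^ 2) := by fun_prop
  have c2 : Continuous fun z => σ (‖g z - w₀‖ ^ 2) *
      ‖fderiv ℝ g z 1 + Complex.I * fderiv ℝ g z Complex.I‖ ^ 2 := by fun_prop
  have c3 : Continuous fun z => σ (‖g z - w₀‖ ^ 2) *
      wedge (fderiv ℝ g z 1) (fderiv ℝ g z Complex.I) := by
    unfold wedge; fun_prop
  have e1 : ∀ z, ENNReal.ofReal (σ (‖g z - w₀‖ ^ 2)) *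
      (‖fderiv ℝ g z 1‖ₑ ^ 2 + ‖fderiv ℝ g z Complex.I‖ₑ ^ 2) =
      ENNReal.ofReal (σ (‖g z - w₀‖ ^ 2) *
        (‖fderiv ℝ g z 1‖ ^ 2 + ‖fderiv ℝ g z Complex.I‖ ^ 2)) := fun z => by
    rw [enorm_sq_eq_ofReal, enorm_sq_eq_ofReal, ← ENNReal.ofReal_add (by positivity)
      (by positivity), ← ENNReal.ofReal_mul (hσ0 _)]
  have e2 : ∀ z, ENNReal.ofReal (σ (‖g z - w₀‖ ^ 2)) *
      ‖fderiv ℝ g z 1 + Complex.I * fderiv ℝ g z Complex.I‖ₑ ^ 2 =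
      ENNReal.ofReal (σ (‖g z - w₀‖ ^ 2) *
        ‖fderiv ℝ g z 1 + Complex.I * fderiv ℝ g z Complex.I‖ ^ 2) := fun z => by
    rw [enorm_sq_eq_ofReal, ← ENNReal.ofReal_mul (hσ0 _)]
  simp only [e1, e2]
  rw [hconv _ c1 fun z => mul_nonneg (hσ0 _) (by positivity),
    hconv _ c2 fun z => mul_nonneg (hσ0 _) (by positivity), ← ENNReal.ofReal_add]
  · congr 1
    rw [mul_assoc, ← hdeg, ← integral_const_mul, ← integral_add ((hin _ c3).const_mul 2) (hin _ c2)]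
    congr 1 with z
    rw [norm_sq_add_norm_sq_eq]
    ring
  · exact mul_nonneg (by positivity) (intervalIntegral.integral_nonneg hm.le fun s _ => hσ0 s)
  · exact integral_nonneg fun z => mul_nonneg (hσ0 _) (by positivity)

/-- Lower energy bound, at a fixed mollification scale. -/
theorem le_lintegral_energy_of_mollify {X : Set ℂ} (hX : IsOpen X) {f fx fy : ℂ → ℂ}
    (hfc : ContinuousOn f X) (hx : HasWeakPartial X f 1 fx) (hy : HasWeakPartial X f Complex.I fy)
    (hf : IntegrableOn f X) (hfx : IntegrableOn fx X) (hfy : IntegrableOn fy X)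
    {z₀ w₀ : ℂ} {R r ρ₁ δ d : ℝ} (hR : 0 < R) (hRX : Metric.closedBall z₀ R ⊆ X)
    (hw : HasWindingNumber (fun t => f (circleMap z₀ R t)) w₀ 1)
    (hfar : ∀ t, r ≤ ‖f (circleMap z₀ R t) - w₀‖)
    (hδ : 0 < δ) (hρ₁ : 0 < ρ₁) (hd : 0 ≤ d) (hρ : ρ₁ + 2 * d ≤ r)
    {σ : ℝ → ℝ} (hσ : Continuous σ) (hσ0 : ∀ s, 0 ≤ σ s) (hσ1 : ∀ s, σ s ≤ 1)
    (h1 : ∀ s < δ, σ s = 1) (h0 : ∀ s, ρ₁ ^ 2 ≤ s → σ s = 0)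
    (ρ : ContDiffBump (0 : ℂ))
    (hball : ∀ z ∈ Metric.closedBall z₀ R, Metric.closedBall z ρ.rOut ⊆ X ∧
      ∀ x ∈ Metric.ball z ρ.rOut, dist (f x) (f z) ≤ d) :
    ENNReal.ofReal (2 * Real.pi * ∫ s in (0 : ℝ)..ρ₁ ^ 2, σ s) +
      ∫⁻ z in Metric.ball z₀ R,
        ENNReal.ofReal (σ (‖mollify ρ (X.indicator f) z - w₀‖ ^ 2)) *
        ‖mollify ρ (X.indicator fun z => fx z + Complex.I * fy z) z‖ₑ ^ 2 ≤
    ∫⁻ z in X ∩ f ⁻¹' Metric.ball w₀ r, (‖fx z‖ₑ ^ 2 + ‖fy z‖ₑ ^ 2) := by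
  have hXm := hX.measurableSet
  have ifi := hf.integrable_indicator hXm
  have ifx := hfx.integrable_indicator hXm
  have ify := hfy.integrable_indicator hXm
  set g := mollify ρ (X.indicator f) with hgdef
  have hg : ContDiff ℝ 2 g := contDiff_infty.1 (contDiff_mollify ρ ifi) 2
  have hclose : ∀ z ∈ Metric.closedBall z₀ R, dist (g z) (f z) ≤ d := by
    intro z hz
    have hzX := (hball z hz).1
    have e0 : X.indicator f z = f z :=
      indicator_of_mem (hzX (Metric.mem_closedBall_self ρ.rOut_pos.le)) f
    have := ρ.dist_normed_convolution_le (μ := volume) (x₀ := z) (ε := d)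
      ifi.aestronglyMeasurable fun x hx => by
        rw [e0, indicator_of_mem (hzX (Metric.ball_subset_closedBall hx))]
        exact (hball z hz).2 x hx
    rwa [e0] at this
  have hcirc : ∀ t, circleMap z₀ R t ∈ Metric.closedBall z₀ R := fun t =>
    circleMap_mem_closedBall z₀ hR.le t
  -- On the circle |g - f| ≤ d < r ≤ |f - w₀|, so g inherits the winding number of f.
  have hgw : HasWindingNumber (fun t => g (circleMap z₀ R t)) w₀ 1 := by
    have hp : circleMap z₀ R (2 * Real.pi) = circleMap z₀ R 0 := by
      have := periodic_circleMap z₀ R 0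
      rwa [zero_add] at this
    refine hw.of_dist_lt ?_ (hg.continuous.comp (continuous_circleMap z₀ R)).continuousOn
      (by rw [hp]) (by rw [hp]) fun t _ => ?_
    · exact hfc.comp (continuous_circleMap z₀ R).continuousOn fun t _ => hRX (hcirc t)
    · have a1 := hclose _ (hcirc t)
      rw [dist_eq_norm] at a1
      linarith [hfar t]
  have hgfar : ∀ t, ρ₁ ^ 2 ≤ ‖g (circleMap z₀ R t) - w₀‖ ^ 2 := by
    intro t
    have a1 := hclose _ (hcirc t)
    have a2 := hfar t
    have a3 := dist_triangle_left (f (circleMap z₀ R t)) w₀ (g (circleMap z₀ R t))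
    rw [dist_eq_norm (f _), dist_eq_norm (g _) w₀] at a3
    have : ρ₁ ≤ ‖g (circleMap z₀ R t) - w₀‖ := by linarith
    gcongr
  have main := lintegral_radial_energy hg hR hδ (pow_pos hρ₁ 2) hσ hσ0 h1 h0 hgw hgfar
  have hbm : MeasurableSet (Metric.ball z₀ R) := Metric.isOpen_ball.measurableSet
  have hgx : ∀ z ∈ Metric.ball z₀ R, fderiv ℝ g z 1 = mollify ρ (X.indicator fx) z := fun z hz =>
    hx.fderiv_mollify hX hf ρ (hball z (Metric.ball_subset_closedBall hz)).1
  have hgy : ∀ z ∈ Metric.ball z₀ R, fderiv ℝ g z Complex.I = mollify ρ (X.indicator fy) z :=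
    fun z hz => hy.fderiv_mollify hX hf ρ (hball z (Metric.ball_subset_closedBall hz)).1
  have hsum : X.indicator (fun z => fx z + Complex.I * fy z) =
      fun z => X.indicator fx z + Complex.I * X.indicator fy z := by
    ext z; by_cases hz : z ∈ X <;> simp [hz]
  have e2 : ∫⁻ z in Metric.ball z₀ R, ENNReal.ofReal (σ (‖g z - w₀‖ ^ 2)) *
        ‖fderiv ℝ g z 1 + Complex.I * fderiv ℝ g z Complex.I‖ₑ ^ 2 =
      ∫⁻ z in Metric.ball z₀ R, ENNReal.ofReal (σ (‖g z - w₀‖ ^ 2)) *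
        ‖mollify ρ (X.indicator fun z => fx z + Complex.I * fy z) z‖ₑ ^ 2 := by
    refine setLIntegral_congr_fun hbm fun z hz => ?_
    simp only [hgx z hz, hgy z hz, hsum, mollify_add_const_mul ρ ifx ify]
  rw [← e2, ← main]
  set B := X ∩ f ⁻¹' Metric.ball w₀ r with hB
  have hBo : IsOpen B := hfc.isOpen_inter_preimage hX Metric.isOpen_ball
  -- Off A the weight vanishes. A point within the mollification radius of A has image within d + d
  -- + ρ₁ ≤ r of w₀, so Jensen's inequality sees only B.
  set A := Metric.ball z₀ R ∩ {z | ‖g z - w₀‖ < ρ₁} with hA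
  have hAm : MeasurableSet A := hbm.inter
    (isOpen_lt (hg.continuous.sub continuous_const).norm continuous_const).measurableSet
  have hAB : ∀ z ∈ A, Metric.ball z ρ.rOut ⊆ B := by
    intro z hz x hxz
    have hzc := Metric.ball_subset_closedBall hz.1
    refine ⟨(hball z hzc).1 (Metric.ball_subset_closedBall hxz), ?_⟩
    have a1 := (hball z hzc).2 x hxz
    have a2 := hclose z hzc
    have a3 : dist (g z) w₀ < ρ₁ := by rw [dist_eq_norm]; exact hz.2
    rw [mem_preimage, Metric.mem_ball]
    have a5 := dist_triangle (f x) (f z) w₀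
    have a6 := dist_triangle_left (f z) w₀ (g z)
    linarith
  have jen : ∀ u : ℂ → ℂ, Integrable (X.indicator u) →
      ∫⁻ z in A, ‖mollify ρ (X.indicator u) z‖ₑ ^ 2 ≤ ∫⁻ z in B, ‖u z‖ₑ ^ 2 := by
    intro u hu
    refine (setLIntegral_enorm_mollify_sq_le ρ hu.aestronglyMeasurable hAm hBo.measurableSet
      hAB).trans (le_of_eq (setLIntegral_congr_fun hBo.measurableSet fun z hz => ?_))
    simp only [indicator_of_mem hz.1]
  have mm : ∀ u : ℂ → ℂ, Integrable u → Measurable fun z => ‖mollify ρ u z‖ₑ ^ 2 := fun u hu =>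
    (contDiff_mollify ρ hu).continuous.measurable.enorm.pow_const 2
  calc ∫⁻ z in Metric.ball z₀ R, ENNReal.ofReal (σ (‖g z - w₀‖ ^ 2)) *
        (‖fderiv ℝ g z 1‖ₑ ^ 2 + ‖fderiv ℝ g z Complex.I‖ₑ ^ 2)
      ≤ ∫⁻ z in A, (‖mollify ρ (X.indicator fx) z‖ₑ ^ 2 +
          ‖mollify ρ (X.indicator fy) z‖ₑ ^ 2) := by
        rw [← lintegral_indicator hbm, ← lintegral_indicator hAm]
        refine lintegral_mono fun z => ?_
        by_cases hz : z ∈ Metric.ball z₀ R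
        · by_cases hz' : ‖g z - w₀‖ < ρ₁
          · rw [indicator_of_mem hz, indicator_of_mem (show z ∈ A from ⟨hz, hz'⟩), hgx z hz,
              hgy z hz]
            refine mul_le_of_le_one_left zero_le ?_
            exact ENNReal.ofReal_le_one.2 (hσ1 _)
          · rw [indicator_of_mem hz, h0 _ (by gcongr; exact not_lt.1 hz'), ENNReal.ofReal_zero,
              zero_mul]
            exact zero_le
        · rw [indicator_of_notMem hz]; exact zero_le
    _ = (∫⁻ z in A, ‖mollify ρ (X.indicator fx) z‖ₑ ^ 2) +
          ∫⁻ z in A, ‖mollify ρ (X.indicator fy) z‖ₑ ^ 2 := lintegral_add_left (mm _ ifx) _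
    _ ≤ (∫⁻ z in B, ‖fx z‖ₑ ^ 2) + ∫⁻ z in B, ‖fy z‖ₑ ^ 2 := add_le_add (jen _ ifx) (jen _ ify)
    _ = _ := by
        refine (lintegral_add_left' ?_ _).symm
        exact ((hfx.aestronglyMeasurable.mono_set inter_subset_left).enorm).pow_const 2

/-! ### Cutoffs and passage to the limit -/

open Filter Topology

/-- Uniform continuity of f on a compact thickening of K inside X. The bound b serves to make
mollification radii tend to 0. -/
theorem IsCompact.exists_uniform_radius {X K : Set ℂ} (hX : IsOpen X) (hK : IsCompact K)
    (hKX : K ⊆ X) {f : ℂ → ℂ} (hf : ContinuousOn f X) {d b : ℝ} (hd : 0 < d) (hb : 0 < b) :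
    ∃ ε, 0 < ε ∧ ε ≤ b ∧ ∀ z ∈ K, Metric.closedBall z ε ⊆ X ∧
      ∀ x ∈ Metric.ball z ε, dist (f x) (f z) ≤ d := by
  obtain ⟨a, ha, haX⟩ := hK.exists_cthickening_subset_open hX hKX
  have hKa : IsCompact (Metric.cthickening a K) := hK.cthickening
  have huc := hKa.uniformContinuousOn_of_continuous (hf.mono haX)
  obtain ⟨η, hη, hη'⟩ := Metric.uniformContinuousOn_iff.1 huc d hd
  have hsub : ∀ z ∈ K, Metric.closedBall z a ⊆ Metric.cthickening a K := fun z hz =>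
    Metric.closedBall_subset_cthickening hz a
  refine ⟨min a (min η b), lt_min ha (lt_min hη hb), (min_le_right _ _).trans (min_le_right _ _),
    fun z hz => ⟨?_, fun x hx => ?_⟩⟩
  · exact ((Metric.closedBall_subset_closedBall (min_le_left _ _)).trans (hsub z hz)).trans haX
  · have hx' : dist x z < min a (min η b) := hx
    refine (hη' x (hsub z hz ?_) z (hsub z hz (Metric.mem_closedBall_self ha.le)) ?_).le
    · exact (hx'.trans_le (min_le_left _ _)).le
    · exact hx'.trans_le ((min_le_right _ _).trans (min_le_left _ _))

/-- A continuous cutoff, equal to `1` on `(-∞, a]` and to `0` on `[b, ∞)`. -/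
noncomputable def linearCutoff (a b s : ℝ) : ℝ := max 0 (min 1 ((b - s) / (b - a)))

theorem continuous_linearCutoff (a b : ℝ) : Continuous (linearCutoff a b) := by
  unfold linearCutoff; fun_prop

theorem linearCutoff_nonneg (a b s : ℝ) : 0 ≤ linearCutoff a b s := le_max_left _ _

theorem linearCutoff_le_one (a b s : ℝ) : linearCutoff a b s ≤ 1 :=
  max_le zero_le_one (min_le_left _ _)

theorem linearCutoff_of_le {a b s : ℝ} (hab : a < b) (hs : s ≤ a) : linearCutoff a b s = 1 := by
  unfold linearCutoff
  rw [min_eq_left ((one_le_div (sub_pos.2 hab)).2 (by linarith)), max_eq_right zero_le_one]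

theorem linearCutoff_of_ge {a b s : ℝ} (hab : a < b) (hs : b ≤ s) : linearCutoff a b s = 0 := by
  unfold linearCutoff
  exact max_eq_left ((min_le_right _ _).trans
    (div_nonpos_of_nonpos_of_nonneg (by linarith) (by linarith)))

theorem le_integral_linearCutoff {a b : ℝ} (ha : 0 ≤ a) (hab : a < b) :
    a ≤ ∫ s in (0 : ℝ)..b, linearCutoff a b s := by
  have hi := fun c d => (continuous_linearCutoff a b).intervalIntegrable (μ := volume) c d
  rw [← intervalIntegral.integral_add_adjacent_intervals (hi 0 a) (hi a b)]
  have h1 : ∫ s in (0 : ℝ)..a, linearCutoff a b s = ∫ s in (0 : ℝ)..a, (1 : ℝ) := by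
    refine intervalIntegral.integral_congr fun s hs => linearCutoff_of_le hab ?_
    rw [uIcc_of_le ha] at hs
    exact hs.2
  have h2 : 0 ≤ ∫ s in a..b, linearCutoff a b s :=
    intervalIntegral.integral_nonneg hab.le fun s _ => linearCutoff_nonneg a b s
  rw [h1]
  simp only [intervalIntegral.integral_const, sub_zero, smul_eq_mul, mul_one]
  linarith

/-- Lower energy bound on the preimage of a disc, with a remainder term. -/
theorem le_lintegral_energy_preimage_ball {X : Set ℂ} (hX : IsOpen X) {f fx fy : ℂ → ℂ}
    (hfc : ContinuousOn f X) (hx : HasWeakPartial X f 1 fx) (hy : HasWeakPartial X f Complex.I fy)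
    (hf : IntegrableOn f X) (hfx : IntegrableOn fx X) (hfy : IntegrableOn fy X)
    {z₀ w₀ : ℂ} {R r : ℝ} (hR : 0 < R) (hRX : Metric.closedBall z₀ R ⊆ X)
    (hw : HasWindingNumber (fun t => f (circleMap z₀ R t)) w₀ 1) (hr : 0 < r)
    (hfar : ∀ t, r ≤ ‖f (circleMap z₀ R t) - w₀‖)
    (hsub : X ∩ f ⁻¹' Metric.ball w₀ r ⊆ Metric.ball z₀ R) :
    ENNReal.ofReal (2 * Real.pi * r ^ 2) +
      ∫⁻ z in X ∩ f ⁻¹' Metric.ball w₀ r, ‖fx z + Complex.I * fy z‖ₑ ^ 2 ≤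
    ∫⁻ z in X ∩ f ⁻¹' Metric.ball w₀ r, (‖fx z‖ₑ ^ 2 + ‖fy z‖ₑ ^ 2) := by
  set B := X ∩ f ⁻¹' Metric.ball w₀ r with hB
  set E := ∫⁻ z in B, (‖fx z‖ₑ ^ 2 + ‖fy z‖ₑ ^ 2) with hE
  have hBm : MeasurableSet B := (hfc.isOpen_inter_preimage hX Metric.isOpen_ball).measurableSet
  have hXm := hX.measurableSet
  -- Any sequence in (0, 1) tending to 1 would do; the shift by 2 keeps τ 0 positive. The tolerance
  -- d below is chosen so that r τ + 2 d = r.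
  let τ : ℕ → ℝ := fun n => 1 - 1 / ((n : ℝ) + 2)
  have hτ0 : ∀ n, 0 < τ n := fun n => by
    have : 1 / ((n : ℝ) + 2) < 1 := by
      rw [div_lt_one (by positivity)]; linarith [n.cast_nonneg (α := ℝ)]
    simpa [τ] using this
  have hτ1 : ∀ n, τ n < 1 := fun n => by
    have : 0 < 1 / ((n : ℝ) + 2) := by positivity
    simp only [τ]; linarith
  have hτ : Tendsto τ atTop (𝓝 1) := by
    have h1 : Tendsto (fun n : ℕ => 1 / ((n : ℝ) + 2)) atTop (𝓝 0) :=
      tendsto_const_nhds.div_atTop (tendsto_atTop_add_const_right _ _ tendsto_natCast_atTop_atTop)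
    simpa only [sub_zero] using h1.const_sub 1
  let d : ℕ → ℝ := fun n => r * (1 - τ n) / 2
  have hd0 : ∀ n, 0 < d n := fun n => by
    have := sub_pos.2 (hτ1 n)
    positivity
  have hd : Tendsto d atTop (𝓝 0) := by
    have := ((hτ.const_sub 1).const_mul r).div_const 2
    simpa using this
  have hK := isCompact_closedBall z₀ R
  choose ε hε0 hεb hε using fun n : ℕ => hK.exists_uniform_radius hX hRX hfc (hd0 n)
    (b := 1 / ((n : ℝ) + 1)) (by positivity)
  let ρ : ℕ → ContDiffBump (0 : ℂ) := fun n => ⟨ε n / 2, ε n, half_pos (hε0 n), half_lt_self (hε0 n)⟩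
  have hρ : Tendsto (fun n => (ρ n).rOut) atTop (𝓝 0) :=
    squeeze_zero (fun n => (hε0 n).le) hεb tendsto_one_div_add_atTop_nhds_zero_nat
  let D : ℂ → ℂ := X.indicator fun z => fx z + Complex.I * fy z
  have hDi : Integrable D := (hfx.add (hfy.const_mul Complex.I)).integrable_indicator hXm
  have ifi := hf.integrable_indicator hXm
  -- The cutoff is 1 up to a and 0 from b on; both thresholds tend to r².
  let a : ℕ → ℝ := fun n => (r * τ n) ^ 2 * τ n
  let b : ℕ → ℝ := fun n => (r * τ n) ^ 2
  have hb0 : ∀ n, 0 < b n := fun n => pow_pos (mul_pos hr (hτ0 n)) 2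
  have ha0 : ∀ n, 0 < a n := fun n => mul_pos (hb0 n) (hτ0 n)
  have hab : ∀ n, a n < b n := fun n => mul_lt_of_lt_one_right (hb0 n) (hτ1 n)
  have hat : Tendsto a atTop (𝓝 (r ^ 2)) := by
    have := ((hτ.const_mul r).pow 2).mul hτ
    simpa using this
  let q : ℕ → ℂ → ℝ≥0∞ := fun n z =>
    ENNReal.ofReal (linearCutoff (a n) (b n) (‖mollify (ρ n) (X.indicator f) z - w₀‖ ^ 2)) *
      ‖mollify (ρ n) D z‖ₑ ^ 2
  have step : ∀ n, ENNReal.ofReal (2 * Real.pi * a n) + ∫⁻ z in B, q n z ≤ E := by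
    intro n
    have := le_lintegral_energy_of_mollify hX hfc hx hy hf hfx hfy hR hRX hw hfar (ha0 n)
      (mul_pos hr (hτ0 n)) (hd0 n).le (by simp only [d]; linarith)
      (continuous_linearCutoff (a n) (b n)) (linearCutoff_nonneg _ _) (linearCutoff_le_one _ _)
      (fun s hs => linearCutoff_of_le (hab n) hs.le) (fun s hs => linearCutoff_of_ge (hab n) hs)
      (ρ n) (hε n)
    refine le_trans (add_le_add (ENNReal.ofReal_le_ofReal ?_) (lintegral_mono_set hsub)) this
    gcongr
    exact le_integral_linearCutoff (ha0 n).le (hab n)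
  have hct : Tendsto (fun n => ENNReal.ofReal (2 * Real.pi * a n)) atTop
      (𝓝 (ENNReal.ofReal (2 * Real.pi * r ^ 2))) :=
    ENNReal.tendsto_ofReal (hat.const_mul _)
  have hCE : ENNReal.ofReal (2 * Real.pi * r ^ 2) ≤ E :=
    le_of_tendsto' hct fun n => le_self_add.trans (step n)
  have hqm : ∀ n, Measurable (q n) := fun n =>
    (((continuous_linearCutoff _ _).comp
      (((contDiff_mollify (ρ n) ifi).continuous.sub continuous_const).norm.pow 2)).measurable.ennreal_ofReal).mul
      ((contDiff_mollify (ρ n) hDi).continuous.measurable.enorm.pow_const 2)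
  -- Lebesgue differentiation: the ratio of outer to inner radius of the bumps is fixed at 2.
  have hmoll : ∀ᵐ z ∂(volume : Measure ℂ), Tendsto (fun n => mollify (ρ n) D z) atTop (𝓝 (D z)) :=
    ContDiffBump.ae_convolution_tendsto_right_of_locallyIntegrable (K := 2) hρ
      (Eventually.of_forall fun n => by simp only [ρ]; linarith) hDi.locallyIntegrable
  have hfmoll : ∀ z ∈ B, Tendsto (fun n => mollify (ρ n) (X.indicator f) z) atTop (𝓝 (f z)) := by
    intro z hz
    have hzK : z ∈ Metric.closedBall z₀ R := Metric.ball_subset_closedBall (hsub hz)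
    rw [tendsto_iff_dist_tendsto_zero]
    refine squeeze_zero (fun n => dist_nonneg) (fun n => ?_) hd
    have e0 : X.indicator f z = f z := indicator_of_mem hz.1 f
    have := (ρ n).dist_normed_convolution_le (μ := volume) (x₀ := z) (ε := d n)
      ifi.aestronglyMeasurable fun x hx => by
        rw [e0, indicator_of_mem ((hε n z hzK).1 (Metric.ball_subset_closedBall hx))]
        exact (hε n z hzK).2 x hx
    rwa [e0] at this
  have fatou : ∫⁻ z in B, ‖fx z + Complex.I * fy z‖ₑ ^ 2 ≤
      liminf (fun n => ∫⁻ z in B, q n z) atTop := by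
    refine le_trans (lintegral_mono_ae ?_) (lintegral_liminf_le hqm)
    filter_upwards [ae_restrict_of_ae hmoll, ae_restrict_mem hBm] with z hz hzB
    have hDz : D z = fx z + Complex.I * fy z := indicator_of_mem hzB.1 _
    rw [hDz] at hz
    have h1 : Tendsto (fun n => ‖mollify (ρ n) D z‖ₑ ^ 2) atTop
        (𝓝 (‖fx z + Complex.I * fy z‖ₑ ^ 2)) :=
      ENNReal.Tendsto.pow hz.enorm
    refine le_of_eq (Tendsto.liminf_eq (h1.congr' ?_)).symm
    have h2 : ‖f z - w₀‖ ^ 2 < r ^ 2 := by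
      have : ‖f z - w₀‖ < r := by rw [← dist_eq_norm]; exact hzB.2
      gcongr
    -- At a point of B, |f - w₀|² < r² = lim a, so the weight is eventually 1 there and q converges
    -- to the full remainder.
    have h3 := (((hfmoll z hzB).sub_const w₀).norm.pow 2).eventually_lt hat h2
    filter_upwards [h3] with n hn
    simp only [q]
    rw [linearCutoff_of_le (hab n) hn.le, ENNReal.ofReal_one, one_mul]
  -- E may be infinite, but the subtracted terms are finite, so subtraction in `ℝ≥0∞` is safe.
  have hlim : Tendsto (fun n => E - ENNReal.ofReal (2 * Real.pi * a n)) atTop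
      (𝓝 (E - ENNReal.ofReal (2 * Real.pi * r ^ 2))) :=
    ENNReal.Tendsto.sub tendsto_const_nhds hct (Or.inr ENNReal.ofReal_ne_top)
  have hle : ∫⁻ z in B, ‖fx z + Complex.I * fy z‖ₑ ^ 2 ≤
      E - ENNReal.ofReal (2 * Real.pi * r ^ 2) := by
    refine fatou.trans (le_of_le_of_eq (liminf_le_liminf (Eventually.of_forall fun n => ?_))
      hlim.liminf_eq)
    exact ENNReal.le_sub_of_add_le_left ENNReal.ofReal_ne_top (step n)
  calc _ ≤ ENNReal.ofReal (2 * Real.pi * r ^ 2) + (E - ENNReal.ofReal (2 * Real.pi * r ^ 2)) := by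
        gcongr
    _ = E := add_tsub_cancel_of_le hCE

/-! ### Weyl's lemma -/

/-- **Weyl's lemma** for the Cauchy-Riemann equations: a continuous weak solution is holomorphic. -/
theorem differentiableOn_of_weak_cauchyRiemann {X : Set ℂ} (hX : IsOpen X) {f fx fy : ℂ → ℂ}
    (hfc : ContinuousOn f X) (hx : HasWeakPartial X f 1 fx) (hy : HasWeakPartial X f Complex.I fy)
    (hf : IntegrableOn f X) (hfx : IntegrableOn fx X) (hfy : IntegrableOn fy X)
    (hCR : ∀ᵐ z ∂volume.restrict X, fx z + Complex.I * fy z = 0) : DifferentiableOn ℂ f X := by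
  intro z₀ hz₀
  have hXm := hX.measurableSet
  have ifi := hf.integrable_indicator hXm
  have ifx := hfx.integrable_indicator hXm
  have ify := hfy.integrable_indicator hXm
  obtain ⟨R, hR, hRX⟩ := Metric.nhds_basis_closedBall.mem_iff.1 (hX.mem_nhds hz₀)
  choose ε hε0 _ hε using fun n : ℕ => (isCompact_closedBall z₀ R).exists_uniform_radius hX hRX hfc
    (d := 1 / ((n : ℝ) + 1)) (by positivity) one_pos
  let ρ : ℕ → ContDiffBump (0 : ℂ) := fun n => ⟨ε n / 2, ε n, half_pos (hε0 n), half_lt_self (hε0 n)⟩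
  -- Mollifications inherit the Cauchy-Riemann equation classically, so they are holomorphic; f is
  -- their uniform limit on the ball.
  have hhol : ∀ n, DifferentiableOn ℂ (mollify (ρ n) (X.indicator f)) (Metric.ball z₀ R) := by
    intro n z hz
    have hzb := (hε n z (Metric.ball_subset_closedBall hz)).1
    refine DifferentiableAt.differentiableWithinAt ?_
    rw [differentiableAt_complex_iff_differentiableAt_real]
    refine ⟨(contDiff_mollify (ρ n) ifi).differentiable (by simp) z, ?_⟩
    rw [hx.fderiv_mollify hX hf (ρ n) hzb, hy.fderiv_mollify hX hf (ρ n) hzb]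
    have h0 : (fun z => X.indicator fx z + Complex.I * X.indicator fy z) =ᵐ[volume] 0 := by
      filter_upwards [(ae_restrict_iff' hXm).1 hCR] with z hz
      by_cases hzX : z ∈ X
      · simpa [hzX] using hz hzX
      · simp [hzX]
    have h1 := mollify_add_const_mul (ρ n) ifx ify Complex.I z
    have h2 : mollify (ρ n) (fun z => X.indicator fx z + Complex.I * X.indicator fy z) z = 0 := by
      rw [mollify, convolution_congr _ (EventuallyEq.refl _ _) h0, convolution_zero]
      rfl
    rw [h2] at h1
    rw [smul_eq_mul]
    linear_combination Complex.I * h1 + mollify (ρ n) (X.indicator fy) z * Complex.I_sq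
  have hunif : TendstoUniformlyOn (fun n => mollify (ρ n) (X.indicator f)) f atTop
      (Metric.ball z₀ R) := by
    rw [Metric.tendstoUniformlyOn_iff]
    intro η hη
    filter_upwards [tendsto_one_div_add_atTop_nhds_zero_nat.eventually_lt_const hη] with n hn z hz
    refine lt_of_le_of_lt ?_ hn
    have hzK := Metric.ball_subset_closedBall hz
    have e0 : X.indicator f z = f z := indicator_of_mem (hRX hzK) f
    have := (ρ n).dist_normed_convolution_le (μ := volume) (x₀ := z) (ε := 1 / ((n : ℝ) + 1))
      ifi.aestronglyMeasurable fun x hx => by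
        rw [e0, indicator_of_mem ((hε n z hzK).1 (Metric.ball_subset_closedBall hx))]
        exact (hε n z hzK).2 x hx
    rw [e0] at this
    rwa [dist_comm]
  have hd := hunif.tendstoLocallyUniformlyOn.differentiableOn (Eventually.of_forall hhol)
    Metric.isOpen_ball
  exact (hd.differentiableAt (Metric.ball_mem_nhds z₀ hR)).differentiableWithinAt

/-! ### Homeomorphisms: local bounds and covering -/

theorem IsHomeomorphOnto.continuousOn {f : ℂ → ℂ} {X Y : Set ℂ} (hf : IsHomeomorphOnto f X Y) :
    ContinuousOn f X := by
  obtain ⟨e, he⟩ := hf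
  rw [continuousOn_iff_continuous_domRestrict]
  exact (continuous_subtype_val.comp e.continuous).congr he

theorem IsHomeomorphOnto.bijOn {f : ℂ → ℂ} {X Y : Set ℂ} (hf : IsHomeomorphOnto f X Y) :
    BijOn f X Y := by
  obtain ⟨e, he⟩ := hf
  refine ⟨fun z hz => ?_, fun z hz z' hz' h => ?_, fun w hw => ?_⟩
  · rw [← he ⟨z, hz⟩]; exact (e ⟨z, hz⟩).2
  · have : e ⟨z, hz⟩ = e ⟨z', hz'⟩ := Subtype.ext (by rw [he, he]; exact h)
    exact congrArg Subtype.val (e.injective this)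
  · exact ⟨e.symm ⟨w, hw⟩, (e.symm ⟨w, hw⟩).2, by rw [← he]; simp⟩

theorem IsHomeomorphOnto.isOpen_image {f : ℂ → ℂ} {X Y U : Set ℂ} (hf : IsHomeomorphOnto f X Y)
    (hY : IsOpen Y) (hU : IsOpen U) (hUX : U ⊆ X) : IsOpen (f '' U) := by
  obtain ⟨e, he⟩ := hf
  have h1 : IsOpen (Subtype.val '' (e '' (Subtype.val ⁻¹' U))) :=
    hY.isOpenMap_subtype_val _ (e.isOpenMap _ (hU.preimage continuous_subtype_val))
  convert! h1 using 1
  ext w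
  constructor
  · rintro ⟨z, hz, rfl⟩
    exact ⟨_, ⟨⟨z, hUX hz⟩, hz, rfl⟩, he _⟩
  · rintro ⟨_, ⟨z, hz, rfl⟩, rfl⟩
    exact ⟨z, hz, (he z).symm⟩

/-- Lower energy bound on the preimages of small discs, for a homeomorphism. -/
theorem IsHomeomorphOnto.exists_le_lintegral_energy {X Y : Set ℂ} (hX : IsOpen X) (hY : IsOpen Y)
    {f fx fy : ℂ → ℂ} (hfh : IsHomeomorphOnto f X Y) (hor : PreservesOrientationOn f X)
    (hx : HasWeakPartial X f 1 fx) (hy : HasWeakPartial X f Complex.I fy)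
    (hf : IntegrableOn f X) (hfx : IntegrableOn fx X) (hfy : IntegrableOn fy X)
    {w : ℂ} (hw : w ∈ Y) :
    ∃ r₀, 0 < r₀ ∧ ∀ r, 0 < r → r ≤ r₀ →
      2 * volume (Metric.ball w r) +
        ∫⁻ z in X ∩ f ⁻¹' Metric.ball w r, ‖fx z + Complex.I * fy z‖ₑ ^ 2 ≤
      ∫⁻ z in X ∩ f ⁻¹' Metric.ball w r, (‖fx z‖ₑ ^ 2 + ‖fy z‖ₑ ^ 2) := by
  obtain ⟨z₀, hz₀, rfl⟩ := hfh.bijOn.surjOn hw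
  obtain ⟨R, hR, hRX⟩ := Metric.nhds_basis_closedBall.mem_iff.1 (hX.mem_nhds hz₀)
  have hbX : Metric.ball z₀ R ⊆ X := Metric.ball_subset_closedBall.trans hRX
  obtain ⟨r₀, hr₀, hball⟩ := Metric.isOpen_iff.1 (hfh.isOpen_image hY Metric.isOpen_ball hbX) (f z₀)
    ⟨z₀, Metric.mem_ball_self hR, rfl⟩
  have hpre : ∀ z ∈ X, f z ∈ Metric.ball (f z₀) r₀ → z ∈ Metric.ball z₀ R := by
    intro z hz hfz
    obtain ⟨z', hz', h⟩ := hball hfz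
    rwa [← hfh.bijOn.injOn (hbX hz') hz h]
  refine ⟨r₀, hr₀, fun r hr hrr => ?_⟩
  have hsub : Metric.ball (f z₀) r ⊆ Metric.ball (f z₀) r₀ := Metric.ball_subset_ball hrr
  -- The disc around f z₀ lies in the image of the open ball, so by injectivity no point of the
  -- boundary circle is sent into it.
  have hfar : ∀ t, r ≤ ‖f (circleMap z₀ R t) - f z₀‖ := by
    intro t
    by_contra! hlt
    rw [← dist_eq_norm] at hlt
    have := hpre _ (hRX (circleMap_mem_closedBall z₀ hR.le t)) (hsub hlt)
    exact circleMap_notMem_ball z₀ R t this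
  have key := le_lintegral_energy_preimage_ball hX hfh.continuousOn hx hy hf hfx hfy hR hRX
    (hor z₀ R hR hRX) hr hfar fun z hz => hpre z hz.1 (hsub hz.2)
  convert! key using 2
  rw [Complex.volume_ball, mul_assoc, ENNReal.ofReal_mul zero_le_two,
    ENNReal.ofReal_mul Real.pi_pos.le, ENNReal.ofReal_pow hr.le, mul_comm (ENNReal.ofReal Real.pi),
    ENNReal.ofReal_ofNat]
  congr 2
  rw [← NNReal.coe_real_pi, ENNReal.ofReal_coe_nnreal]

/-- For the part of X missed by the covering: the uncovered part of Y is null, but its preimage is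
not known to be. This crude bound holds there, and it is the source of the factor ½ in the global
remainder. -/
theorem enorm_add_I_mul_sq_le (a b : ℂ) :
    2⁻¹ * ‖a + Complex.I * b‖ₑ ^ 2 ≤ ‖a‖ₑ ^ 2 + ‖b‖ₑ ^ 2 := by
  have h : (2 : ℝ≥0∞)⁻¹ = ENNReal.ofReal 2⁻¹ := by
    rw [ENNReal.ofReal_inv_of_pos two_pos]; simp
  rw [enorm_sq_eq_ofReal, enorm_sq_eq_ofReal, enorm_sq_eq_ofReal,
    ← ENNReal.ofReal_add (by positivity) (by positivity), h, ← ENNReal.ofReal_mul (by norm_num)]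
  refine ENNReal.ofReal_le_ofReal ?_
  simp only [← Complex.normSq_eq_norm_sq, Complex.normSq_apply]
  simp
  nlinarith [sq_nonneg (a.re + b.im), sq_nonneg (a.im - b.re)]

/-- The energy of an orientation preserving Sobolev homeomorphism is at least twice the area of the
image, with a remainder controlling the weak Cauchy-Riemann operator. -/
theorem IsHomeomorphOnto.le_lintegral_energy {X Y : Set ℂ} (hX : IsOpen X) (hY : IsOpen Y)
    {f fx fy : ℂ → ℂ} (hfh : IsHomeomorphOnto f X Y) (hor : PreservesOrientationOn f X)
    (hx : HasWeakPartial X f 1 fx) (hy : HasWeakPartial X f Complex.I fy)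
    (hf : IntegrableOn f X) (hfx : IntegrableOn fx X) (hfy : IntegrableOn fy X) :
    2 * volume Y + ∫⁻ z in X, 2⁻¹ * ‖fx z + Complex.I * fy z‖ₑ ^ 2 ≤
      ∫⁻ z in X, (‖fx z‖ₑ ^ 2 + ‖fy z‖ₑ ^ 2) := by
  choose! r₀ hr₀ hloc using fun (w : ℂ) (hw : w ∈ Y) =>
    hfh.exists_le_lintegral_energy hX hY hor hx hy hf hfx hfy hw
  -- All radii are taken below r₀, so the local bound holds on every disc.
  obtain ⟨t, r, htc, htY, htr, hcov, hdisj⟩ := Besicovitch.exists_disjoint_closedBall_covering_ae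
    volume (fun _ => univ) Y (fun x _ δ hδ => ⟨δ / 2, trivial, half_pos hδ, half_lt_self hδ⟩) r₀ hr₀
  let B : ℂ → Set ℂ := fun w => X ∩ f ⁻¹' Metric.ball w (r w)
  have hBm : ∀ w ∈ t, MeasurableSet (B w) := fun w _ =>
    (hfh.continuousOn.isOpen_inter_preimage hX Metric.isOpen_ball).measurableSet
  have hBd : t.PairwiseDisjoint B := fun w hw w' hw' hne =>
    ((hdisj hw hw' hne).mono Metric.ball_subset_closedBall Metric.ball_subset_closedBall).preimage f
      |>.mono inter_subset_right inter_subset_right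
  set U := ⋃ w ∈ t, B w with hU
  have hUm : MeasurableSet U := MeasurableSet.biUnion htc hBm
  have hUX : U ⊆ X := iUnion₂_subset fun w _ => inter_subset_left
  have hvol : volume Y ≤ ∑' w : t, volume (Metric.ball (w : ℂ) (r w)) := by
    calc volume Y ≤ volume (Y \ ⋃ w ∈ t, Metric.closedBall w (r w)) +
          volume (⋃ w ∈ t, Metric.closedBall w (r w)) :=
          (measure_mono (by simp)).trans (measure_union_le _ _)
      _ ≤ ∑' w : t, volume (Metric.closedBall (w : ℂ) (r w)) := by
          rw [hcov, zero_add]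
          exact measure_biUnion_le _ htc _
      _ = _ := by
          congr 1 with w
          exact Measure.addHaar_closedBall_eq_addHaar_ball _ _ _
  have hsum : 2 * volume Y + ∫⁻ z in U, ‖fx z + Complex.I * fy z‖ₑ ^ 2 ≤
      ∫⁻ z in U, (‖fx z‖ₑ ^ 2 + ‖fy z‖ₑ ^ 2) := by
    rw [hU, lintegral_biUnion htc hBm hBd, lintegral_biUnion htc hBm hBd]
    calc _ ≤ 2 * ∑' w : t, volume (Metric.ball (w : ℂ) (r w)) +
          ∑' w : t, ∫⁻ z in B w, ‖fx z + Complex.I * fy z‖ₑ ^ 2 := by gcongr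
      _ = ∑' w : t, (2 * volume (Metric.ball (w : ℂ) (r w)) +
          ∫⁻ z in B w, ‖fx z + Complex.I * fy z‖ₑ ^ 2) := by
          rw [ENNReal.tsum_add, ENNReal.tsum_mul_left]
      _ ≤ _ := ENNReal.tsum_le_tsum fun w =>
          hloc w (htY w.2) (r w) (htr w w.2).2.1 (htr w w.2).2.2.le
  have split : ∀ k : ℂ → ℝ≥0∞, ∫⁻ z in X, k z = (∫⁻ z in U, k z) + ∫⁻ z in X \ U, k z := by
    intro k
    rw [← lintegral_inter_add_sdiff k X hUm, inter_eq_right.2 hUX]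
  rw [split, split, ← add_assoc]
  -- On U the local bounds give the full remainder, of which half is kept; off U the crude bound
  -- applies.
  refine add_le_add (le_trans ?_ hsum) (lintegral_mono fun z => enorm_add_I_mul_sq_le _ _)
  gcongr with z
  exact mul_le_of_le_one_left zero_le (ENNReal.inv_le_one.2 one_le_two)

/-! ### The main theorem -/

theorem mainTheorem11 (X Y : Set ℂ) (hX : IsBoundedDomain X) (hY : IsBoundedDomain Y)
    (h : ℂ → ℂ) (hh : IsConformalOnto h X Y)
    (f : ℂ → ℂ) (hf : IsHomeomorphOnto f X Y) (hor : PreservesOrientationOn f X)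
    (hfW : MemSobolevOneTwo X f) :
    dirichletEnergy X h ≤ dirichletEnergy X f ∧
      (dirichletEnergy X f = dirichletEnergy X h ↔ IsConformalOnto f X Y) := by
  obtain ⟨hf2, fx, fy, hx, hy, hfx2, hfy2⟩ := hfW
  have : IsFiniteMeasure (volume.restrict X) := ⟨by
    rw [Measure.restrict_apply_univ]; exact hX.isBounded.measure_lt_top⟩
  have hfi : IntegrableOn f X := hf2.integrable one_le_two
  have hfxi : IntegrableOn fx X := hfx2.integrable one_le_two
  have hfyi : IntegrableOn fy X := hfy2.integrable one_le_two
  have key := hf.le_lintegral_energy hX.isOpen hY.isOpen hor hx hy hfi hfxi hfyi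
  rw [← dirichletEnergy_eq hX.isOpen hx hy] at key
  have hE := hh.dirichletEnergy_eq hX.isOpen
  refine ⟨?_, fun heq => ⟨?_, hf.bijOn⟩, fun hc => ?_⟩
  · rw [hE]; exact le_self_add.trans key
  · refine differentiableOn_of_weak_cauchyRiemann hX.isOpen hf.continuousOn hx hy hfi hfxi hfyi ?_
    -- Boundedness of Y makes 2|Y| finite, so it can be cancelled and the remainder must be 0.
    have hYfin : 2 * volume Y ≠ ⊤ :=
      ENNReal.mul_ne_top ENNReal.ofNat_ne_top hY.isBounded.measure_lt_top.ne
    rw [heq, hE] at key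
    have hzero : ∫⁻ z in X, 2⁻¹ * ‖fx z + Complex.I * fy z‖ₑ ^ 2 = 0 := by
      by_contra hne
      exact absurd key (not_le.2 (ENNReal.lt_add_right hYfin hne))
    have hm : AEMeasurable (fun z => (2 : ℝ≥0∞)⁻¹ * ‖fx z + Complex.I * fy z‖ₑ ^ 2)
        (volume.restrict X) :=
      (((hfxi.aestronglyMeasurable.add
        (hfyi.aestronglyMeasurable.const_mul Complex.I)).enorm).pow_const 2).const_mul _
    filter_upwards [(lintegral_eq_zero_iff' hm).1 hzero] with z hz
    simpa using hz
  · rw [hE, hc.dirichletEnergy_eq hX.isOpen]
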